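/- Let $p,m\ge 1$ be integers, let $\mathbf n=(n_1,\dots,n_p)\in\mathbb Z_+^p$ (where $\mathbb Z_+=\{0,1,2,\dots\}$), and let $f:\mathbb R^p\to\mathbb R$ be $2m$-times continuously differentiable, with partial derivatives $f^{(\boldsymbol\alpha)}$, $\boldsymbol\alpha\in\mathbb Z_+^p$. Notation. For vectors, $\le$ and products are coordinatewise; $\mathbf 1=(1,\dots,1)$, $\mathbf 0=(0,\dots,0)$, $\|\boldsymbol\alpha\|=\alpha_1+\dots+\alpha_p$, $\boldsymbol\alpha!=\alpha_1!\cdots\alpha_p!$, $\mathbf x^{\boldsymbol\alpha}=x_1^{\alpha_1}\cdots x_p^{\alpha_p}$, $|\boldsymbol\beta|=(|\beta_1|,\dots,|\beta_p|)$. A sum $\sum_{\mathbf i=\mathbf a}^{\mathbf b}$ is over all integer vectors $\mathbf i$ with $\mathbf a\le\mathbf i\le\mathbf b$; an empty sum is $0$. For $\mathbf u,\mathbf v\in\mathbb R^p$, $\int_{\mathbf u}^{\mathbf v}d\mathbf x\,h(\mathbf x)$ is the Lebesgue integral of $h$ over $\prod_r[\min(u_r,v_r),\max(u_r,v_r)]$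 multiplied by $(-1)^{\#\{r:\,u_r>v_r\}}$, and $\int_{\mathbf u}^{\mathbf v}:=\int_{\mathbf u}^{\mathbf v}d\mathbf x\,f(\mathbf x)$. For integers $j\ge1$ let $$\gamma_{m,j}=(-1)^{j-1}\frac2j\binom{2m}{m+j}\Big/\binom{2m}{m},\qquad \tau_{m,j}=\sum_{\beta=0}^{\lfloor (m-j)/2\rfloor}\gamma_{m,j+2\beta}\quad(1\le j\le m),$$ and $\gamma_{m,\mathbf j}=\prod_{r=1}^p\gamma_{m,j_r}$, $\tau_{m,\mathbf j}=\prod_{r=1}^p\tau_{m,j_r}$. Then the following hold. (i) $\displaystyle\sum_{\mathbf k=\mathbf 0}^{\mathbf n-\mathbf 1}f(\mathbf k)=A_m-R_m$, where $$\begin{aligned}A_m&:=\sum_{\mathbf j=\mathbf 1}^{m\mathbf 1}\gamma_{m,\mathbf j}\sum_{\mathbf i=\mathbf 0}^{\mathbf j-\mathbf 1}\int_{\mathbf i-\mathbf j/2}^{\mathbf n-\mathbf 1+\mathbf j/2-\mathbf i}=\sum_{\mathbf j=\mathbf 1}^{m\mathbf 1}\gamma_{m,\mathbf j}\sum_{\mathbf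 i=\mathbf 0}^{\mathbf j-\mathbf 1}\int_{-\mathbf 1+\mathbf j/2-\mathbf i}^{\mathbf n-\mathbf 1+\mathbf j/2-\mathbf i}\\ &=\sum_{\boldsymbol\beta=(1-m)\mathbf 1}^{(m-1)\mathbf 1}\tau_{m,\mathbf 1+|\boldsymbol\beta|}\int_{\boldsymbol\beta/2-\mathbf 1/2}^{\mathbf n-\mathbf 1/2-\boldsymbol\beta/2}=\sum_{\boldsymbol\beta=(1-m)\mathbf 1}^{(m-1)\mathbf 1}\tau_{m,\mathbf 1+|\boldsymbol\beta|}\int_{-\mathbf 1/2-\boldsymbol\beta/2}^{\mathbf n-\mathbf 1/2-\boldsymbol\beta/2}\\ &=\sum_{\boldsymbol\alpha=\mathbf 0}^{(m-1)\mathbf 1}\tau_{m,\mathbf 1+\boldsymbol\alpha}\sum_{\boldsymbol\beta\in\mathbb Z^p:\,|\boldsymbol\beta|=\boldsymbol\alpha}\int_{\boldsymbol\beta/2-\mathbf 1/2}^{\mathbf n-\mathbf 1/2-\boldsymbol\beta/2}=\sum_{\boldsymbol\alpha=\mathbf 0}^{(m-1)\mathbf 1}\tau_{m,\mathbf 1+\boldsymbol\alpha}\sum_{\boldsymbol\beta\in\mathbb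 Z^p:\,|\boldsymbol\beta|=\boldsymbol\alpha}\int_{-\mathbf 1/2-\boldsymbol\beta/2}^{\mathbf n-\mathbf 1/2-\boldsymbol\beta/2}\end{aligned}$$ and $$R_m:=\frac{m}{2^{2m+p-1}}\sum_{\|\boldsymbol\alpha\|=2m}\frac1{\boldsymbol\alpha!}\int_0^1ds\,(1-s)^{2m-1}\int_{-\mathbf 1}^{\mathbf 1}d\mathbf v\,\mathbf v^{\boldsymbol\alpha}\sum_{\mathbf j=\mathbf 1}^{m\mathbf 1}\gamma_{m,\mathbf j}\,\mathbf j^{\boldsymbol\alpha+\mathbf 1}\sum_{\mathbf k=\mathbf 0}^{\mathbf n-\mathbf 1}f^{(\boldsymbol\alpha)}(\mathbf k+s\,\mathbf j\mathbf v/2).$$ Moreover, $\tau_{m,j}=\sum_{\beta=0}^\infty\gamma_{m,j+2\beta}$ for $1\le j\le m$. (ii) The coefficients of the integrals in each of these expressions for $A_m$ sum to $1$: $$\sum_{\mathbf j=\mathbf 1}^{m\mathbf 1}\gamma_{m,\mathbf j}\sum_{\mathbf i=\mathbf 0}^{\mathbf j-\mathbf 1}1=\sum_{\mathbf j=\mathbf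 1}^{m\mathbf 1}\gamma_{m,\mathbf j}\,\mathbf j^{\mathbf 1}=\sum_{\boldsymbol\beta=(1-m)\mathbf 1}^{(m-1)\mathbf 1}\tau_{m,\mathbf 1+|\boldsymbol\beta|}=\sum_{\boldsymbol\alpha=\mathbf 0}^{(m-1)\mathbf 1}\tau_{m,\mathbf 1+\boldsymbol\alpha}\sum_{\boldsymbol\beta:\,|\boldsymbol\beta|=\boldsymbol\alpha}1=1.$$ (iii) If $M_{2m}$ is a real number such that $\big|\sum_{\mathbf k=\mathbf 0}^{\mathbf n-\mathbf 1}f^{(\boldsymbol\alpha)}(\mathbf k+\mathbf u)\big|\le M_{2m}$ for all $\boldsymbol\alpha\in\mathbb Z_+^p$ with $\|\boldsymbol\alpha\|=2m$ and all $\mathbf u\in(-m/2,m/2]^p$, then $$|R_m|\le\frac{M_{2m}}{2^{2m}}\sum_{\|\boldsymbol\alpha\|=2m}\frac1{(\boldsymbol\alpha+\mathbf 1)!}\sum_{\mathbf j=\mathbf 1}^{m\mathbf 1}|\gamma_{m,\mathbf j}|\,\mathbf j^{\boldsymbol\alpha+\mathbf 1}\le M_{2m}\,\frac{1.0331\,(\pi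 m)^{(p+1)/2}}{(2m+1)!}\,(\kappa pm)^{2m},$$ where $\kappa:=\sqrt{\Lambda_*/4}=0.27754\ldots$ and $\Lambda_*:=\max_{0<t<1}\Lambda(t)=0.3081\ldots$ (the maximum being attained) with $\Lambda(t):=(1-t)^{t-1}(1+t)^{-1-t}t^2$. If $m\ge2$, the factor $1.0331$ can be replaced by $1.001$. -/

import Mathlib

namespace AltSum

noncomputable section

/-- The multi-indices `k` with `0 ≤ k ≤ n - 1` coordinatewise, i.e. `0 ≤ k r < n r` for every `r`
(there are none if some `n r = 0`). -/
def below {p : ℕ} (n : Fin p → ℕ) : Finset (Fin p → ℕ) :=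
  Fintype.piFinset fun r => Finset.range (n r)

/-- The multi-indices `j` with `1 ≤ j r ≤ m` for every `r`. -/
def upTo (p m : ℕ) : Finset (Fin p → ℕ) :=
  Finset.Icc (fun _ => 1) (fun _ => m)

/-- The integer vectors `β` with `1 - m ≤ β r ≤ m - 1` for every `r`. -/
def symBox (p m : ℕ) : Finset (Fin p → ℤ) :=
  Finset.Icc (fun _ => 1 - (m : ℤ)) (fun _ => (m : ℤ) - 1)

/-- The coordinatewise absolute value of an integer vector. -/
def absVec {p : ℕ} (β : Fin p → ℤ) : Fin p → ℕ := fun r => (β r).natAbs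

/-- All integer vectors `β` whose coordinatewise absolute value is `α`. -/
def signed {p : ℕ} (α : Fin p → ℕ) : Finset (Fin p → ℤ) :=
  (Finset.Icc (fun r => -(α r : ℤ)) (fun r => (α r : ℤ))).filter fun β => absVec β = α

/-- The multi-indices `α` with `α 1 + ⋯ + α p = d`. -/
def ofDegree (p d : ℕ) : Finset (Fin p → ℕ) :=
  Finset.piAntidiag Finset.univ d

/-- The first-order partial derivative in the coordinate `r`. -/
def partialDeriv {p : ℕ} (r : Fin p) (f : (Fin p → ℝ) → ℝ) : (Fin p → ℝ) → ℝ :=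
  fun x => lineDeriv ℝ f x (Pi.single r 1)

/-- The iterated partial derivative `∂₁^{α₁} ⋯ ∂ₚ^{αₚ} f`. -/
def multiDeriv {p : ℕ} (α : Fin p → ℕ) (f : (Fin p → ℝ) → ℝ) : (Fin p → ℝ) → ℝ :=
  (List.finRange p).foldr (fun r g => (partialDeriv r)^[α r] g) f

/-- The oriented integral of `h` from the corner `u` to the corner `v`: the Lebesgue integral over
the box `[u ∧ v, u ∨ v]` times `-1` for each coordinate with `u r > v r`. -/
def boxInt {p : ℕ} (u v : Fin p → ℝ) (h : (Fin p → ℝ) → ℝ) : ℝ :=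
  (-1) ^ (Finset.univ.filter fun r => v r < u r).card * ∫ x in Set.Icc (u ⊓ v) (u ⊔ v), h x

/-- The coefficient `γ_{m,j}`, for `j ≥ 1`. -/
def gam (m j : ℕ) : ℝ :=
  (-1) ^ (j - 1) * (2 / (j : ℝ)) * ((2 * m).choose (m + j) : ℝ) / ((2 * m).choose m : ℝ)

/-- The product coefficient `γ_{m,j}` for a multi-index `j`. -/
def gamVec {p : ℕ} (m : ℕ) (j : Fin p → ℕ) : ℝ := ∏ r, gam m (j r)

/-- The coefficient `τ_{m,j}`, for `1 ≤ j ≤ m`: the sum of `γ_{m,j+2β}` over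
`β = 0, …, ⌊(m - j)/2⌋`. -/
def tau (m j : ℕ) : ℝ := ∑ β ∈ Finset.range ((m - j) / 2 + 1), gam m (j + 2 * β)

/-- The product coefficient `τ_{m,j}` for a multi-index `j`. -/
def tauVec {p : ℕ} (m : ℕ) (j : Fin p → ℕ) : ℝ := ∏ r, tau m (j r)

/-- The integral approximation `A_m` (first of its six forms). -/
def approx {p : ℕ} (m : ℕ) (n : Fin p → ℕ) (f : (Fin p → ℝ) → ℝ) : ℝ :=
  ∑ j ∈ upTo p m, gamVec m j * ∑ i ∈ below j,
    boxInt (fun r => (i r : ℝ) - (j r : ℝ) / 2)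
      (fun r => (n r : ℝ) - 1 + (j r : ℝ) / 2 - (i r : ℝ)) f

/-- The remainder `R_m`. -/
def remainder {p : ℕ} (m : ℕ) (n : Fin p → ℕ) (f : (Fin p → ℝ) → ℝ) : ℝ :=
  (m : ℝ) / 2 ^ (2 * m + p - 1) *
    ∑ α ∈ ofDegree p (2 * m), 1 / (∏ r, ((α r).factorial : ℝ)) *
      ∫ s in (0 : ℝ)..1, (1 - s) ^ (2 * m - 1) *
        boxInt (fun _ => -1) (fun _ => 1) (fun v =>
          (∏ r, v r ^ α r) *
            ∑ j ∈ upTo p m, gamVec m j * (∏ r, (j r : ℝ) ^ (α r + 1)) *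
              ∑ k ∈ below n, multiDeriv α f (fun r => (k r : ℝ) + s * (j r : ℝ) * v r / 2))

/-- The first upper bound on the absolute value of the remainder. -/
def remainderBound (p m : ℕ) (M : ℝ) : ℝ :=
  M / 2 ^ (2 * m) *
    ∑ α ∈ ofDegree p (2 * m), 1 / (∏ r, ((α r + 1).factorial : ℝ)) *
      ∑ j ∈ upTo p m, |gamVec m j| * ∏ r, (j r : ℝ) ^ (α r + 1)

/-- The function `Λ(t) = (1 - t)^(t - 1) (1 + t)^(-1 - t) t²` for `0 < t < 1`. -/
def Lam (t : ℝ) : ℝ := (1 - t) ^ (t - 1) * (1 + t) ^ (-1 - t) * t ^ 2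

/-- `Λ_*`, the maximum of `Λ` on `(0, 1)` (written as a supremum). -/
def LamStar : ℝ := sSup (Lam '' Set.Ioo 0 1)

/-- The constant `κ = √(Λ_* / 4)`. -/
def kap : ℝ := Real.sqrt (LamStar / 4)

/-- The closed-form upper bound on the remainder with numerical factor `c`. -/
def closedBound (p m : ℕ) (c M : ℝ) : ℝ :=
  M * (c * (Real.pi * m) ^ (((p : ℝ) + 1) / 2) / ((2 * m + 1).factorial : ℝ)) *
    (kap * p * m) ^ (2 * m)

end

end AltSum

open MeasureTheory

namespace AltSum

/-! ### The coefficients -/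

/-! The weights are chosen so that ∑ γ_{m,j} j^(2l+1) is 1 for l = 0 and 0 for 0 < l < m
(`sum_gam_mul_pow`). This is the vanishing of the 2m-th finite difference on polynomials of degree
below 2m, folded at its centre. Taylor-expand f around k to order 2m and integrate over the boxes
with centre k and sides j: monomials with an odd exponent vanish by symmetry, the other non-constant
ones are killed by the weights. Hence the γ-combination of these box integrals is f(k) plus a
weighted Taylor remainder (`sum_gamVec_mul_integral_translate`). Summing over k gives A_m and R_m.

The forms of A_m agree because an oriented box integral is the integral of f against a product, over
the coordinates, of differences of step functions (`boxInt_eq_integral`). The equalities thus become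
pointwise identities between kernels. These factor into one-variable identities valid for an
arbitrary function: a double telescoping (`sum_shifted_differences`), a reflection of the index, and
the substitution β = 2i - j + 1, which collects γ into τ (`sum_gam_mul_sum_eq_sum_tau`).

For the closed bound put c_j = j |γ_{m,j}|. The multinomial theorem and a power mean inequality
bound the sum over α and j by p^(2m) (∑ c_j)^(p-1) ∑ c_j j^(2m) / (2m+1)!. Wallis' product gives ∑
c_j ≤ √(π m). In the last sum log-convexity of the Stirling sequence bounds the binomial ratio times
t^(2m), with t = j/m < 1, by Λ(t)^m / √(1 - t²); replacing Λ(t) by Λ_* leaves a lower Riemann sum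
for arcsin, whence the factor π m Λ_*^m. The case m = 1 alone needs the constant 1.0331, and 2 ≤ m ≤
7 is checked numerically. -/

theorem alternating_sum_choose_mul_sub_pow {N k : ℕ} (h : k < N) (c : ℝ) :
    ∑ i ∈ Finset.range (N + 1), (-1 : ℝ) ^ (N - i) * (N.choose i : ℝ) * ((i : ℝ) - c) ^ k = 0 := by
  have h1 := congrFun (fwdDiff_iter_pow_eq_zero_of_lt (R := ℝ) h) (-c)
  rw [fwdDiff_iter_eq_sum_shift] at h1
  rw [Pi.zero_apply] at h1
  rw [← h1]
  refine Finset.sum_congr rfl fun i _ => ?_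
  simp only [zsmul_eq_mul, nsmul_eq_mul, mul_one]
  push_cast
  ring

theorem sum_gam_mul_pow {m l : ℕ} (h : l < m) :
    ∑ j ∈ Finset.Icc 1 m, gam m j * (j : ℝ) ^ (2 * l + 1) = if l = 0 then 1 else 0 := by
  have hc : ((2 * m).choose m : ℝ) ≠ 0 := by
    exact_mod_cast (Nat.choose_pos (by omega)).ne'
  have h0 := alternating_sum_choose_mul_sub_pow (N := 2 * m) (k := 2 * l) (by omega) m
  -- The range 0, …, 2m is cut at the centre m; the index m + j and its mirror image m - j give
  -- equal terms because the exponent 2l is even.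
  have hsplit : 2 * m + 1 = (m + 1) + m := by omega
  rw [hsplit, Finset.sum_range_add, Finset.sum_range_succ,
    ← Finset.sum_range_reflect (n := m)] at h0
  have hup : ∀ j ∈ Finset.range m, (-1 : ℝ) ^ (2 * m - (m + 1 + j)) *
      ((2 * m).choose (m + 1 + j) : ℝ) * (((m + 1 + j : ℕ) : ℝ) - m) ^ (2 * l) =
      (-1) ^ m * ((-1 : ℝ) ^ (1 + j) * ((2 * m).choose (m + (1 + j)) : ℝ) *
        ((1 + j : ℕ) : ℝ) ^ (2 * l)) := by
    intro j hj
    rw [Finset.mem_range] at hj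
    have e1 : (-1 : ℝ) ^ (2 * m - (m + 1 + j)) = (-1) ^ m * (-1) ^ (1 + j) := by
      rw [← pow_add, neg_one_pow_eq_pow_mod_two, neg_one_pow_eq_pow_mod_two (n := m + (1 + j))]
      congr 1; omega
    rw [e1, ← add_assoc]
    push_cast
    ring
  have hlow : ∀ j ∈ Finset.range m, (-1 : ℝ) ^ (2 * m - (m - 1 - j)) *
      ((2 * m).choose (m - 1 - j) : ℝ) * (((m - 1 - j : ℕ) : ℝ) - m) ^ (2 * l) =
      (-1) ^ m * ((-1 : ℝ) ^ (1 + j) * ((2 * m).choose (m + (1 + j)) : ℝ) *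
        ((1 + j : ℕ) : ℝ) ^ (2 * l)) := by
    intro j hj
    rw [Finset.mem_range] at hj
    have e1 : (-1 : ℝ) ^ (2 * m - (m - 1 - j)) = (-1) ^ m * (-1) ^ (1 + j) := by
      rw [← pow_add, neg_one_pow_eq_pow_mod_two, neg_one_pow_eq_pow_mod_two (n := m + (1 + j))]
      congr 1; omega
    have e2 : (2 * m).choose (m - 1 - j) = (2 * m).choose (m + (1 + j)) := by
      rw [← Nat.choose_symm (by omega : m - 1 - j ≤ 2 * m)]
      congr 1; omega
    have e3 : ((m - 1 - j : ℕ) : ℝ) - m = -((1 + j : ℕ) : ℝ) := by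
      have : ((m - 1 - j + (1 + j) : ℕ) : ℝ) = m := by congr 1; omega
      push_cast at this ⊢
      linarith
    rw [e1, e2, e3, (even_two_mul l).neg_pow]
    ring
  rw [Finset.sum_congr rfl hup, Finset.sum_congr rfl hlow, ← Finset.mul_sum] at h0
  have hmid : 2 * m - m = m := by omega
  rw [hmid, sub_self] at h0
  have hne : ((-1 : ℝ) ^ m) ≠ 0 := by simp
  set T := ∑ j ∈ Finset.range m, (-1 : ℝ) ^ (1 + j) * ((2 * m).choose (m + (1 + j)) : ℝ) *
    ((1 + j : ℕ) : ℝ) ^ (2 * l) with hT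
  -- The central term carries 0 ^ (2 * l), which is 1 exactly when l = 0: this is the source of the
  -- single nonzero moment.
  have hT2 : 2 * T + ((2 * m).choose m : ℝ) * 0 ^ (2 * l) = 0 := by
    apply mul_left_cancel₀ hne
    linear_combination h0
  have hsum : ∑ j ∈ Finset.Icc 1 m, gam m j * (j : ℝ) ^ (2 * l + 1) =
      -(2 * T) / ((2 * m).choose m : ℝ) := by
    rw [← Finset.Ico_add_one_right_eq_Icc, Finset.sum_Ico_eq_sum_range, hT, Finset.mul_sum,
      ← Finset.sum_neg_distrib, Finset.sum_div, Nat.add_sub_cancel]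
    refine Finset.sum_congr rfl fun j _ => ?_
    have hj : ((1 + j : ℕ) : ℝ) ≠ 0 := by positivity
    rw [gam, Nat.add_sub_cancel_left, pow_add (-1 : ℝ) 1 j]
    field_simp
    ring
  rw [hsum, show -(2 * T) = ((2 * m).choose m : ℝ) * 0 ^ (2 * l) by linarith]
  rcases Nat.eq_zero_or_pos l with rfl | hl
  · simp [hc]
  · simp [hl.ne']

theorem sum_gam_mul_self {m : ℕ} (hm : 1 ≤ m) :
    ∑ j ∈ Finset.Icc 1 m, gam m j * (j : ℝ) = 1 := by
  simpa using sum_gam_mul_pow (m := m) (l := 0) hm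

theorem gam_eq_zero {m j : ℕ} (h : m < j) : gam m j = 0 := by
  rw [gam, Nat.choose_eq_zero_of_lt (by omega)]
  simp

theorem hasSum_tau (m j : ℕ) : HasSum (fun β : ℕ => gam m (j + 2 * β)) (tau m j) := by
  refine hasSum_sum_of_ne_finset_zero fun b hb => gam_eq_zero ?_
  rw [Finset.mem_range] at hb
  omega

/-- For fixed j the numbers β = 2i - j + 1 run over the integers of the parity of j - 1 with |β| ≤ j
- 1. A given β therefore arises from j = 1 + |β| + 2b with b ≥ 0, and the weights of these j add up
to τ. -/
theorem sum_gam_mul_sum_eq_sum_tau (m : ℕ) (G : ℤ → ℝ) :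
    ∑ j ∈ Finset.Icc 1 m, gam m j * ∑ i ∈ Finset.range j, G (2 * (i : ℤ) - j + 1) =
      ∑ β ∈ Finset.Icc (1 - (m : ℤ)) ((m : ℤ) - 1), tau m (1 + β.natAbs) * G β := by
  simp only [tau, Finset.mul_sum, Finset.sum_mul]
  rw [Finset.sum_sigma', Finset.sum_sigma']
  refine Finset.sum_bij'
    (fun x _ => ⟨2 * (x.2 : ℤ) - x.1 + 1, (x.1 - 1 - (2 * (x.2 : ℤ) - x.1 + 1).natAbs) / 2⟩)
    (fun y _ => ⟨1 + y.1.natAbs + 2 * y.2, ((y.1 + y.1.natAbs + 2 * y.2) / 2).toNat⟩) ?_ ?_ ?_ ?_ ?_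
  · rintro ⟨j, i⟩ h
    simp only [Finset.mem_sigma, Finset.mem_Icc, Finset.mem_range] at h ⊢
    omega
  · rintro ⟨β, b⟩ h
    simp only [Finset.mem_sigma, Finset.mem_Icc, Finset.mem_range] at h ⊢
    omega
  · rintro ⟨j, i⟩ h
    simp only [Finset.mem_sigma, Finset.mem_Icc, Finset.mem_range] at h
    simp only [Sigma.mk.injEq, heq_eq_eq]
    omega
  · rintro ⟨β, b⟩ h
    simp only [Finset.mem_sigma, Finset.mem_Icc, Finset.mem_range] at h
    simp only [Sigma.mk.injEq, heq_eq_eq]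
    omega
  · rintro ⟨j, i⟩ h
    simp only [Finset.mem_sigma, Finset.mem_Icc, Finset.mem_range] at h
    simp only
    congr 2
    omega

/-! ### Factorization of multi-index sums over the coordinates -/

theorem upTo_eq (p m : ℕ) : upTo p m = Fintype.piFinset fun _ => Finset.Icc 1 m := rfl

theorem symBox_eq (p m : ℕ) :
    symBox p m = Fintype.piFinset fun _ => Finset.Icc (1 - (m : ℤ)) ((m : ℤ) - 1) := rfl

theorem sum_gamVec_mul_prod {p : ℕ} (m : ℕ) (w : Fin p → ℕ → ℝ) :
    ∑ j ∈ upTo p m, gamVec m j * ∏ r, w r (j r) =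
      ∏ r, ∑ j ∈ Finset.Icc 1 m, gam m j * w r j := by
  rw [Finset.prod_univ_sum, upTo_eq]
  simp only [gamVec, Finset.prod_mul_distrib]

theorem sum_gamVec_mul_sum_prod {p : ℕ} (m : ℕ) (w : Fin p → ℕ → ℕ → ℝ) :
    ∑ j ∈ upTo p m, gamVec m j * ∑ i ∈ below j, ∏ r, w r (j r) (i r) =
      ∏ r, ∑ j ∈ Finset.Icc 1 m, gam m j * ∑ i ∈ Finset.range j, w r j i := by
  rw [← sum_gamVec_mul_prod]
  simp only [below, Finset.prod_univ_sum]

theorem sum_tauVec_mul_prod {p : ℕ} (m : ℕ) (w : Fin p → ℤ → ℝ) :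
    ∑ β ∈ symBox p m, tauVec m (1 + absVec β) * ∏ r, w r (β r) =
      ∏ r, ∑ b ∈ Finset.Icc (1 - (m : ℤ)) ((m : ℤ) - 1), tau m (1 + b.natAbs) * w r b := by
  rw [Finset.prod_univ_sum, symBox_eq]
  simp only [tauVec, Finset.prod_mul_distrib]
  rfl

theorem sum_gamVec_eq_sum_tauVec {p : ℕ} (m : ℕ) (w : Fin p → ℤ → ℝ) :
    ∑ j ∈ upTo p m, gamVec m j * ∑ i ∈ below j, ∏ r, w r (2 * (i r : ℤ) - j r + 1) =
      ∑ β ∈ symBox p m, tauVec m (1 + absVec β) * ∏ r, w r (β r) := by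
  rw [sum_tauVec_mul_prod, sum_gamVec_mul_sum_prod m fun r j i => w r (2 * (i : ℤ) - j + 1)]
  simp only [sum_gam_mul_sum_eq_sum_tau]

theorem mem_signed {p : ℕ} {α : Fin p → ℕ} {β : Fin p → ℤ} : β ∈ signed α ↔ absVec β = α := by
  simp only [signed, Finset.mem_filter, Finset.mem_Icc, Pi.le_def, and_iff_right_iff_imp]
  rintro rfl
  exact ⟨fun r => by simp only [absVec]; omega, fun r => by simp only [absVec]; omega⟩

/-- The fibres of `absVec` over the multi-indices below m partition `symBox p m`, and the weight is
constant on each fibre. -/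
theorem sum_below_signed {p m : ℕ} (hm : 1 ≤ m) (w : (Fin p → ℤ) → ℝ) :
    ∑ α ∈ below (fun _ : Fin p => m), tauVec m (1 + α) * ∑ β ∈ signed α, w β =
      ∑ β ∈ symBox p m, tauVec m (1 + absVec β) * w β := by
  have hmap : ∀ β ∈ symBox p m, absVec β ∈ below (fun _ : Fin p => m) := by
    intro β hβ
    simp only [symBox_eq, below, Fintype.mem_piFinset, Finset.mem_Icc, Finset.mem_range,
      absVec] at hβ ⊢
    intro r
    have := hβ r
    omega
  rw [← Finset.sum_fiberwise_of_maps_to hmap]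
  refine Finset.sum_congr rfl fun α hα => ?_
  have hfib : (symBox p m).filter (fun β => absVec β = α) = signed α := by
    ext β
    rw [Finset.mem_filter, mem_signed, and_iff_right_iff_imp]
    rintro rfl
    simp only [symBox_eq, below, Fintype.mem_piFinset, Finset.mem_Icc, Finset.mem_range,
      absVec] at hα ⊢
    intro r
    have := hα r
    omega
  rw [hfib, Finset.mul_sum]
  refine Finset.sum_congr rfl fun β hβ => ?_
  rw [mem_signed.1 hβ]

theorem sum_gamVec_mul_prod_self {p m : ℕ} (hm : 1 ≤ m) :
    ∑ j ∈ upTo p m, gamVec m j * ∏ r, (j r : ℝ) = 1 := by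
  rw [sum_gamVec_mul_prod m fun _ j => (j : ℝ)]
  simp [sum_gam_mul_self hm]

theorem sum_below_one {p : ℕ} (j : Fin p → ℕ) : ∑ _i ∈ below j, (1 : ℝ) = ∏ r, (j r : ℝ) := by
  simp [below]

theorem sum_gamVec_mul_sum_one {p m : ℕ} (hm : 1 ≤ m) :
    ∑ j ∈ upTo p m, gamVec m j * ∑ _i ∈ below j, (1 : ℝ) = 1 := by
  simp only [sum_below_one, sum_gamVec_mul_prod_self hm]

theorem sum_tauVec {p m : ℕ} (hm : 1 ≤ m) :
    ∑ β ∈ symBox p m, tauVec m (1 + absVec β) = 1 := by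
  have h := sum_gamVec_eq_sum_tauVec (p := p) m fun _ _ => 1
  simp only [Finset.prod_const_one, mul_one] at h
  rw [← h, sum_gamVec_mul_sum_one hm]

/-- Each difference over a length j is a sum of j unit differences. After exchanging the sums, the
one over k telescopes, so n differences of length j become j differences of length n. Reversing i in
the upper endpoints gives the symmetric pairing. An arbitrary `H` allows the use with step
functions. -/
theorem sum_shifted_differences (H : ℝ → ℝ) (n j : ℕ) :
    ∑ k ∈ Finset.range n, (H ((k : ℝ) + (j : ℝ) / 2) - H ((k : ℝ) - (j : ℝ) / 2)) =
      ∑ i ∈ Finset.range j, (H ((n : ℝ) - 1 + (j : ℝ) / 2 - i) - H ((i : ℝ) - (j : ℝ) / 2)) := by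
  have hswap : ∑ k ∈ Finset.range n, (H ((k : ℝ) + (j : ℝ) / 2) - H ((k : ℝ) - (j : ℝ) / 2)) =
      ∑ i ∈ Finset.range j, (H ((n : ℝ) + ((i : ℝ) - (j : ℝ) / 2)) - H ((i : ℝ) - (j : ℝ) / 2)) := by
    have h1 : ∀ k : ℕ, H ((k : ℝ) + (j : ℝ) / 2) - H ((k : ℝ) - (j : ℝ) / 2) =
        ∑ i ∈ Finset.range j, (H ((k : ℝ) + ((i : ℝ) - (j : ℝ) / 2) + 1) -
          H ((k : ℝ) + ((i : ℝ) - (j : ℝ) / 2))) := by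
      intro k
      have := Finset.sum_range_sub (fun i : ℕ => H ((k : ℝ) + ((i : ℝ) - (j : ℝ) / 2))) j
      simp only [Nat.cast_add, Nat.cast_one, Nat.cast_zero] at this
      rw [show (k : ℝ) + (j : ℝ) / 2 = k + (j - (j : ℝ) / 2) by ring,
        show (k : ℝ) - (j : ℝ) / 2 = k + (0 - (j : ℝ) / 2) by ring, ← this]
      refine Finset.sum_congr rfl fun i _ => ?_
      rw [show (k : ℝ) + ((i : ℝ) - (j : ℝ) / 2) + 1 = k + ((i : ℝ) + 1 - (j : ℝ) / 2) by ring]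
    simp only [h1]
    rw [Finset.sum_comm]
    refine Finset.sum_congr rfl fun i _ => ?_
    have := Finset.sum_range_sub (fun k : ℕ => H ((k : ℝ) + ((i : ℝ) - (j : ℝ) / 2))) n
    simp only [Nat.cast_add, Nat.cast_one, Nat.cast_zero] at this
    rw [zero_add] at this
    rw [← this]
    refine Finset.sum_congr rfl fun k _ => ?_
    rw [show (k : ℝ) + ((i : ℝ) - (j : ℝ) / 2) + 1 = (k : ℝ) + 1 + ((i : ℝ) - (j : ℝ) / 2) by ring]
  rw [hswap, Finset.sum_sub_distrib, Finset.sum_sub_distrib]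
  congr 1
  rw [← Finset.sum_range_reflect]
  refine Finset.sum_congr rfl fun i hi => ?_
  rw [Finset.mem_range] at hi
  have : ((j - 1 - i : ℕ) : ℝ) = j - 1 - i := by
    have : ((j - 1 - i + (1 + i) : ℕ) : ℝ) = j := by congr 1; omega
    push_cast at this ⊢
    linarith
  rw [this]
  congr 1
  ring

theorem sum_reflected_differences (H : ℝ → ℝ) (n : ℝ) (j : ℕ) :
    ∑ i ∈ Finset.range j, (H (n - 1 + (j : ℝ) / 2 - i) - H ((i : ℝ) - (j : ℝ) / 2)) =
      ∑ i ∈ Finset.range j, (H (n - 1 + (j : ℝ) / 2 - i) - H (-1 + (j : ℝ) / 2 - i)) := by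
  rw [Finset.sum_sub_distrib, Finset.sum_sub_distrib]
  congr 1
  rw [← Finset.sum_range_reflect]
  refine Finset.sum_congr rfl fun i hi => ?_
  rw [Finset.mem_range] at hi
  have : ((j - 1 - i : ℕ) : ℝ) = j - 1 - i := by
    have : ((j - 1 - i + (1 + i) : ℕ) : ℝ) = j := by congr 1; omega
    push_cast at this ⊢
    linarith
  rw [this]
  congr 1
  ring

/-! ### Oriented box integrals and the forms of the approximation -/

section

/-- The indicator of `x ≤ a`, as a function of the threshold `a`. -/
noncomputable def step (x a : ℝ) : ℝ := if x ≤ a then 1 else 0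

/-- Half-open intervals make this exact at every point, so the telescoping identities hold
pointwise; null sets enter only in `boxInt_eq_integral`. -/
theorem step_sub_step (x u v : ℝ) :
    step x v - step x u =
      (if v < u then -1 else 1) * (Set.Ioc (u ⊓ v) (u ⊔ v)).indicator 1 x := by
  simp only [step, Set.indicator, Set.mem_Ioc, inf_lt_iff, le_sup_iff, Pi.one_apply]
  split_ifs <;> grind

theorem prod_step_sub_step {p : ℕ} (u v x : Fin p → ℝ) :
    ∏ r, (step (x r) (v r) - step (x r) (u r)) =
      (-1) ^ (Finset.univ.filter fun r => v r < u r).card *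
        (Set.univ.pi fun r => Set.Ioc ((u ⊓ v) r) ((u ⊔ v) r)).indicator 1 x := by
  simp only [step_sub_step, Finset.prod_mul_distrib]
  congr 1
  · rw [Finset.prod_ite]
    simp
  · by_cases h : x ∈ Set.univ.pi fun r => Set.Ioc ((u ⊓ v) r) ((u ⊔ v) r)
    · rw [Set.indicator_of_mem h]
      refine Finset.prod_eq_one fun r _ => ?_
      rw [Set.indicator_of_mem (by simpa using h r (Set.mem_univ r))]
      rfl
    · rw [Set.indicator_of_notMem h]
      simp only [Set.mem_univ_pi, not_forall] at h
      obtain ⟨r, hr⟩ := h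
      exact Finset.prod_eq_zero (Finset.mem_univ r) (Set.indicator_of_notMem (by simpa using hr) _)

theorem prod_step_mul_eq {p : ℕ} (u v : Fin p → ℝ) (f : (Fin p → ℝ) → ℝ) (x : Fin p → ℝ) :
    (∏ r, (step (x r) (v r) - step (x r) (u r))) * f x =
      (-1) ^ (Finset.univ.filter fun r => v r < u r).card *
        (Set.univ.pi fun r => Set.Ioc ((u ⊓ v) r) ((u ⊔ v) r)).indicator f x := by
  rw [prod_step_sub_step, mul_assoc]
  congr 1
  simp only [Set.indicator, Pi.one_apply]
  split_ifs <;> simp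

theorem measurableSet_univ_pi_Ioc {p : ℕ} (u v : Fin p → ℝ) :
    MeasurableSet (Set.univ.pi fun r => Set.Ioc (u r) (v r)) :=
  MeasurableSet.univ_pi fun _ => measurableSet_Ioc

theorem boxInt_eq_integral {p : ℕ} (u v : Fin p → ℝ) (f : (Fin p → ℝ) → ℝ) :
    boxInt u v f = ∫ x, (∏ r, (step (x r) (v r) - step (x r) (u r))) * f x := by
  simp only [prod_step_mul_eq]
  rw [integral_const_mul, integral_indicator (measurableSet_univ_pi_Ioc _ _), boxInt, volume_pi,
    setIntegral_congr_set Measure.univ_pi_Ioc_ae_eq_Icc]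

theorem integrable_prod_step_mul {p : ℕ} (u v : Fin p → ℝ) {f : (Fin p → ℝ) → ℝ}
    (hf : Continuous f) :
    Integrable fun x => (∏ r, (step (x r) (v r) - step (x r) (u r))) * f x := by
  simp only [prod_step_mul_eq]
  refine Integrable.const_mul ?_ _
  rw [integrable_indicator_iff (measurableSet_univ_pi_Ioc _ _)]
  refine (hf.continuousOn.integrableOn_compact (isCompact_Icc (a := u ⊓ v) (b := u ⊔ v))).mono_set
    fun x hx => ⟨fun r => (hx r (Set.mem_univ r)).1.le, fun r => (hx r (Set.mem_univ r)).2⟩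

/-- Gathering a combination of box integrals under one integral sign reduces an equality between two
such combinations to an equality of their kernels. -/
theorem sum_mul_sum_boxInt {p : ℕ} {ι κ : Type*} (S : Finset ι) (c : ι → ℝ) (T : ι → Finset κ)
    (a b : ι → κ → Fin p → ℝ) {f : (Fin p → ℝ) → ℝ} (hf : Continuous f) :
    ∑ j ∈ S, c j * ∑ i ∈ T j, boxInt (a j i) (b j i) f =
      ∫ x, (∑ j ∈ S, c j * ∑ i ∈ T j,
        ∏ r, (step (x r) (b j i r) - step (x r) (a j i r))) * f x := by
  have hint : ∀ j i, Integrable fun x : Fin p → ℝ =>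
      (∏ r, (step (x r) (b j i r) - step (x r) (a j i r))) * f x :=
    fun j i => integrable_prod_step_mul _ _ hf
  simp only [Finset.sum_mul, mul_assoc]
  rw [integral_finsetSum _ fun j _ => (integrable_finsetSum _ fun i _ => hint j i).const_mul _]
  refine Finset.sum_congr rfl fun j _ => ?_
  rw [integral_const_mul, integral_finsetSum _ fun i _ => hint j i]
  simp only [boxInt_eq_integral]

theorem sum_mul_boxInt {p : ℕ} {ι : Type*} (S : Finset ι) (c : ι → ℝ)
    (a b : ι → Fin p → ℝ) {f : (Fin p → ℝ) → ℝ} (hf : Continuous f) :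
    ∑ j ∈ S, c j * boxInt (a j) (b j) f =
      ∫ x, (∑ j ∈ S, c j * ∏ r, (step (x r) (b j r) - step (x r) (a j r))) * f x := by
  simpa using sum_mul_sum_boxInt S c (fun _ => ({()} : Finset Unit)) (fun j _ => a j)
    (fun j _ => b j) hf

variable {p : ℕ} (m : ℕ) (n : Fin p → ℕ) {f : (Fin p → ℝ) → ℝ}

theorem approx_eq_sum_translates (hf : Continuous f) :
    approx m n f = ∑ j ∈ upTo p m, gamVec m j * ∑ k ∈ below n,
      boxInt (fun r => (k r : ℝ) - (j r : ℝ) / 2) (fun r => (k r : ℝ) + (j r : ℝ) / 2) f := by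
  -- Both kernels are now products over r of one-variable sums, compared by
  -- `sum_shifted_differences` with H the step function at x r.
  rw [approx, sum_mul_sum_boxInt _ _ _ _ _ hf, sum_mul_sum_boxInt _ _ _ _ _ hf]
  congr 1 with x
  congr 1
  refine Finset.sum_congr rfl fun j _ => ?_
  rw [below, below, ← Finset.prod_univ_sum (fun r => Finset.range (j r)) fun r i =>
      step (x r) ((n r : ℝ) - 1 + (j r : ℝ) / 2 - i) - step (x r) ((i : ℝ) - (j r : ℝ) / 2),
    ← Finset.prod_univ_sum (fun r => Finset.range (n r)) fun r k =>
      step (x r) ((k : ℝ) + (j r : ℝ) / 2) - step (x r) ((k : ℝ) - (j r : ℝ) / 2)]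
  simp only [sum_shifted_differences]

theorem approx_eq_sum_shifted (hf : Continuous f) :
    approx m n f = ∑ j ∈ upTo p m, gamVec m j * ∑ i ∈ below j,
      boxInt (fun r => -1 + (j r : ℝ) / 2 - (i r : ℝ))
        (fun r => (n r : ℝ) - 1 + (j r : ℝ) / 2 - (i r : ℝ)) f := by
  rw [approx, sum_mul_sum_boxInt _ _ _ _ _ hf, sum_mul_sum_boxInt _ _ _ _ _ hf]
  congr 1 with x
  congr 1
  rw [sum_gamVec_mul_sum_prod m fun r j i =>
      step (x r) ((n r : ℝ) - 1 + (j : ℝ) / 2 - i) - step (x r) ((i : ℝ) - (j : ℝ) / 2),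
    sum_gamVec_mul_sum_prod m fun r j i =>
      step (x r) ((n r : ℝ) - 1 + (j : ℝ) / 2 - i) - step (x r) (-1 + (j : ℝ) / 2 - i)]
  simp only [sum_reflected_differences]

theorem approx_eq_sum_tau (hf : Continuous f) :
    approx m n f = ∑ β ∈ symBox p m, tauVec m (1 + absVec β) *
      boxInt (fun r => (β r : ℝ) / 2 - 1 / 2) (fun r => (n r : ℝ) - 1 / 2 - (β r : ℝ) / 2) f := by
  rw [approx, sum_mul_sum_boxInt _ _ _ _ _ hf, sum_mul_boxInt _ _ _ _ hf]
  congr 1 with x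
  congr 1
  rw [← sum_gamVec_eq_sum_tauVec m fun r b =>
    step (x r) ((n r : ℝ) - 1 / 2 - (b : ℝ) / 2) - step (x r) ((b : ℝ) / 2 - 1 / 2)]
  refine Finset.sum_congr rfl fun j _ => congrArg _ <| Finset.sum_congr rfl fun i _ =>
    Finset.prod_congr rfl fun r _ => ?_
  push_cast
  congr 2 <;> ring

theorem approx_eq_sum_tau_shifted (hf : Continuous f) :
    approx m n f = ∑ β ∈ symBox p m, tauVec m (1 + absVec β) *
      boxInt (fun r => -1 / 2 - (β r : ℝ) / 2) (fun r => (n r : ℝ) - 1 / 2 - (β r : ℝ) / 2) f := by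
  rw [approx_eq_sum_shifted m n hf, sum_mul_sum_boxInt _ _ _ _ _ hf, sum_mul_boxInt _ _ _ _ hf]
  congr 1 with x
  congr 1
  rw [← sum_gamVec_eq_sum_tauVec m fun r b =>
    step (x r) ((n r : ℝ) - 1 / 2 - (b : ℝ) / 2) - step (x r) (-1 / 2 - (b : ℝ) / 2)]
  refine Finset.sum_congr rfl fun j _ => congrArg _ <| Finset.sum_congr rfl fun i _ =>
    Finset.prod_congr rfl fun r _ => ?_
  push_cast
  congr 2 <;> ring

end

/-! ### Partial derivatives and the Taylor formula -/

section

variable {p : ℕ}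

theorem partialDeriv_eq_fderiv {f : (Fin p → ℝ) → ℝ} (hf : Differentiable ℝ f) (r : Fin p) :
    partialDeriv r f = fun x => fderiv ℝ f x (Pi.single r 1) :=
  funext fun x => (hf x).lineDeriv_eq_fderiv

theorem contDiff_partialDeriv {N : ℕ} {f : (Fin p → ℝ) → ℝ}
    (hf : ContDiff ℝ ((N + 1 : ℕ) : WithTop ℕ∞) f) (r : Fin p) :
    ContDiff ℝ (N : WithTop ℕ∞) (partialDeriv r f) := by
  rw [partialDeriv_eq_fderiv (hf.differentiable (by simp))]
  exact (hf.fderiv_right (by norm_cast)).clm_apply contDiff_const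

theorem contDiff_partialDeriv_iterate {N k : ℕ} {f : (Fin p → ℝ) → ℝ}
    (hf : ContDiff ℝ ((N + k : ℕ) : WithTop ℕ∞) f) (r : Fin p) :
    ContDiff ℝ (N : WithTop ℕ∞) ((partialDeriv r)^[k] f) := by
  induction k generalizing f with
  | zero => exact hf
  | succ k ih => exact ih (contDiff_partialDeriv hf r)

theorem partialDeriv_comm {f : (Fin p → ℝ) → ℝ} (hf : ContDiff ℝ ((2 : ℕ) : WithTop ℕ∞) f)
    (r s : Fin p) : partialDeriv r (partialDeriv s f) = partialDeriv s (partialDeriv r f) := by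
  have hd : Differentiable ℝ f := hf.differentiable (by simp)
  have hd2 : Differentiable ℝ (fderiv ℝ f) :=
    (hf.fderiv_right (m := 1) (by norm_cast)).differentiable (by simp)
  have key : ∀ a b : Fin p, ∀ x, partialDeriv a (partialDeriv b f) x =
      fderiv ℝ (fderiv ℝ f) x (Pi.single a 1) (Pi.single b 1) := by
    intro a b x
    rw [partialDeriv_eq_fderiv ((contDiff_partialDeriv (N := 1) hf b).differentiable (by simp)),
      partialDeriv_eq_fderiv hd]
    simp only
    rw [fderiv_clm_apply (hd2 x) (differentiableAt_const _)]
    simp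
  funext x
  rw [key, key]
  exact (hf.contDiffAt.isSymmSndFDerivAt (by simp)) _ _

theorem partialDeriv_iterate_comm {k : ℕ} {f : (Fin p → ℝ) → ℝ}
    (hf : ContDiff ℝ ((k + 1 : ℕ) : WithTop ℕ∞) f) (r s : Fin p) :
    (partialDeriv s)^[k] (partialDeriv r f) = partialDeriv r ((partialDeriv s)^[k] f) := by
  induction k generalizing f with
  | zero => rfl
  | succ k ih =>
    rw [Function.iterate_succ_apply, Function.iterate_succ_apply, ← ih (contDiff_partialDeriv hf s),
      partialDeriv_comm (hf.of_le (by norm_cast; omega))]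

/-- The iterated partial derivatives along the directions in a list. -/
noncomputable def listDeriv (l : List (Fin p)) (α : Fin p → ℕ) (f : (Fin p → ℝ) → ℝ) :
    (Fin p → ℝ) → ℝ :=
  l.foldr (fun r g => (partialDeriv r)^[α r] g) f

theorem contDiff_listDeriv {N : ℕ} (l : List (Fin p)) (α : Fin p → ℕ) {f : (Fin p → ℝ) → ℝ}
    (hf : ContDiff ℝ ((N + (l.map α).sum : ℕ) : WithTop ℕ∞) f) :
    ContDiff ℝ (N : WithTop ℕ∞) (listDeriv l α f) := by
  induction l generalizing N with
  | nil => simpa [listDeriv] using hf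
  | cons a l ih =>
    refine contDiff_partialDeriv_iterate (k := α a) (ih ?_) a
    simpa [add_assoc] using hf

theorem listDeriv_partialDeriv (l : List (Fin p)) (α : Fin p → ℕ) {f : (Fin p → ℝ) → ℝ}
    (hf : ContDiff ℝ ((1 + (l.map α).sum : ℕ) : WithTop ℕ∞) f) (r : Fin p) :
    listDeriv l α (partialDeriv r f) = partialDeriv r (listDeriv l α f) := by
  induction l with
  | nil => rfl
  | cons a l ih =>
    have h1 : (1 + ((a :: l).map α).sum : ℕ) = (α a + 1) + (l.map α).sum := by
      simp; ring
    have h2 := ih (hf.of_le (by rw [h1]; norm_cast; omega))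
    rw [h1] at hf
    change (partialDeriv a)^[α a] (listDeriv l α (partialDeriv r f)) =
      partialDeriv r ((partialDeriv a)^[α a] (listDeriv l α f))
    rw [h2, partialDeriv_iterate_comm (contDiff_listDeriv l α hf)]

theorem listDeriv_congr (l : List (Fin p)) {α β : Fin p → ℕ} (h : ∀ r ∈ l, α r = β r)
    (f : (Fin p → ℝ) → ℝ) : listDeriv l α f = listDeriv l β f := by
  induction l with
  | nil => rfl
  | cons a l ih =>
    change (partialDeriv a)^[α a] (listDeriv l α f) = (partialDeriv a)^[β a] (listDeriv l β f)
    rw [ih fun r hr => h r (List.mem_cons_of_mem _ hr), h a List.mem_cons_self]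

/-- An extra derivative in direction r is moved outward until it meets the block belonging to r.
Without repetitions in the list there is only one such block, so the exponent rises by exactly one.
-/
theorem listDeriv_partialDeriv_of_mem (l : List (Fin p)) (hl : l.Nodup) (α : Fin p → ℕ)
    {f : (Fin p → ℝ) → ℝ} (hf : ContDiff ℝ ((1 + (l.map α).sum : ℕ) : WithTop ℕ∞) f)
    {r : Fin p} (hr : r ∈ l) :
    listDeriv l α (partialDeriv r f) = listDeriv l (α + Pi.single r 1) f := by
  induction l with
  | nil => simp at hr
  | cons a l ih =>
    have h1 : (1 + ((a :: l).map α).sum : ℕ) = α a + (1 + (l.map α).sum) := by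
      simp; ring
    have hf' : ContDiff ℝ ((1 + (l.map α).sum : ℕ) : WithTop ℕ∞) f :=
      hf.of_le (by rw [h1]; norm_cast; omega)
    rw [List.nodup_cons] at hl
    change (partialDeriv a)^[α a] (listDeriv l α (partialDeriv r f)) =
      (partialDeriv a)^[(α + Pi.single r 1 : Fin p → ℕ) a] (listDeriv l (α + Pi.single r 1) f)
    by_cases har : a = r
    · subst har
      rw [listDeriv_partialDeriv l α hf',
        listDeriv_congr l (α := α + Pi.single a 1) (β := α) (fun s hs => ?_) f]
      · simp
      · have : s ≠ a := fun h => hl.1 (h ▸ hs)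
        simp [this]
    · rw [ih hl.2 hf' ((List.mem_cons.1 hr).resolve_left (Ne.symm har))]
      simp [har]

theorem sum_finRange_map (α : Fin p → ℕ) : ((List.finRange p).map α).sum = ∑ r, α r := by
  rw [← List.ofFn_eq_map, List.sum_ofFn]

theorem contDiff_multiDeriv {N : ℕ} (α : Fin p → ℕ) {f : (Fin p → ℝ) → ℝ}
    (hf : ContDiff ℝ ((N + ∑ r, α r : ℕ) : WithTop ℕ∞) f) :
    ContDiff ℝ (N : WithTop ℕ∞) (multiDeriv α f) :=
  contDiff_listDeriv (List.finRange p) α (by rwa [sum_finRange_map])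

theorem continuous_multiDeriv {N : ℕ} (α : Fin p → ℕ) {f : (Fin p → ℝ) → ℝ}
    (hf : ContDiff ℝ (N : WithTop ℕ∞) f) (hα : ∑ r, α r ≤ N) :
    Continuous (multiDeriv α f) :=
  (contDiff_multiDeriv (N := 0) α (hf.of_le (by norm_cast; omega))).continuous

theorem multiDeriv_partialDeriv (α : Fin p → ℕ) {f : (Fin p → ℝ) → ℝ}
    (hf : ContDiff ℝ ((1 + ∑ r, α r : ℕ) : WithTop ℕ∞) f) (r : Fin p) :
    multiDeriv α (partialDeriv r f) = multiDeriv (α + Pi.single r 1) f :=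
  listDeriv_partialDeriv_of_mem (List.finRange p) (List.nodup_finRange p) α
    (by rwa [sum_finRange_map]) (List.mem_finRange r)

theorem multiDeriv_zero (f : (Fin p → ℝ) → ℝ) : multiDeriv 0 f = f := by
  unfold multiDeriv
  induction List.finRange p with
  | nil => rfl
  | cons a l ih => simp

/-! ### Multinomial coefficients and derivatives along a line -/

theorem mem_ofDegree {d : ℕ} {α : Fin p → ℕ} : α ∈ ofDegree p d ↔ ∑ r, α r = d := by
  simp [ofDegree]

theorem prod_add_single {M : Type*} [CommMonoid M] (g : Fin p → ℕ → M) (α : Fin p → ℕ)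
    (r : Fin p) : ∏ s, g s ((α + Pi.single r 1 : Fin p → ℕ) s) =
      g r (α r + 1) * ∏ s ∈ Finset.univ.erase r, g s (α s) := by
  rw [← Finset.mul_prod_erase _ _ (Finset.mem_univ r)]
  congr 1
  · simp
  · refine Finset.prod_congr rfl fun s hs => ?_
    simp [Finset.ne_of_mem_erase hs]

/-- Pascal's rule for multinomial coefficients: β is reached from β minus a unit vector in direction
r whenever β r ≥ 1, with weight d! β_r / β!, and these weights add up to (d+1)! / β! because the β_r
sum to d + 1. -/
theorem sum_ofDegree_add_single (d : ℕ) (T : (Fin p → ℕ) → ℝ) :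
    ∑ α ∈ ofDegree p d, ∑ r, (d.factorial : ℝ) / (∏ s, ((α s).factorial : ℝ)) *
        T (α + Pi.single r 1) =
      ∑ β ∈ ofDegree p (d + 1), ((d + 1).factorial : ℝ) / (∏ s, ((β s).factorial : ℝ)) * T β := by
  have hrhs : ∀ β ∈ ofDegree p (d + 1),
      ((d + 1).factorial : ℝ) / (∏ s, ((β s).factorial : ℝ)) * T β =
      ∑ r, if 1 ≤ β r then
        (d.factorial : ℝ) * (β r : ℝ) / (∏ s, ((β s).factorial : ℝ)) * T β else 0 := by
    intro β hβ
    have h0 : ∀ r, (if 1 ≤ β r then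
        (d.factorial : ℝ) * (β r : ℝ) / (∏ s, ((β s).factorial : ℝ)) * T β else 0) =
        (β r : ℝ) * ((d.factorial : ℝ) / (∏ s, ((β s).factorial : ℝ)) * T β) := by
      intro r
      split_ifs with h
      · ring
      · rw [show β r = 0 by omega]
        simp
    simp only [h0]
    rw [← Finset.sum_mul, ← Nat.cast_sum, mem_ofDegree.1 hβ, Nat.factorial_succ]
    push_cast
    ring
  rw [Finset.sum_congr rfl hrhs, Finset.sum_comm, Finset.sum_comm (s := ofDegree p (d + 1))]
  refine Finset.sum_congr rfl fun r _ => ?_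
  rw [← Finset.sum_filter]
  refine Finset.sum_bij' (fun α _ => α + Pi.single r 1) (fun β _ => β - Pi.single r 1)
    ?_ ?_ ?_ ?_ ?_
  · intro α hα
    rw [mem_ofDegree] at hα
    rw [Finset.mem_filter, mem_ofDegree]
    simp [Finset.sum_add_distrib, hα]
  · intro β hβ
    rw [Finset.mem_filter, mem_ofDegree] at hβ
    rw [mem_ofDegree]
    have hle : ∀ s ∈ Finset.univ, (Pi.single r 1 : Fin p → ℕ) s ≤ β s := by
      intro s _
      by_cases hs : s = r
      · subst hs; simpa using hβ.2
      · simp [hs]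
    simp only [Pi.sub_apply]
    rw [Finset.sum_tsub_distrib _ hle, hβ.1]
    simp
  · intro α _
    simp
  · intro β hβ
    rw [Finset.mem_filter] at hβ
    funext s
    by_cases hs : s = r
    · subst hs; simp; omega
    · simp [hs]
  · intro α _
    congr 1
    rw [prod_add_single (fun _ k => (k.factorial : ℝ)),
      ← Finset.mul_prod_erase Finset.univ (fun s => ((α s).factorial : ℝ)) (Finset.mem_univ r)]
    have h1 : ∏ s ∈ Finset.univ.erase r, ((α s).factorial : ℝ) ≠ 0 :=
      Finset.prod_ne_zero_iff.2 fun s _ => by positivity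
    have h2 : ((α r).factorial : ℝ) ≠ 0 := by positivity
    have h3 : ((α r : ℝ) + 1) ≠ 0 := by positivity
    rw [Nat.factorial_succ]
    simp only [Pi.add_apply, Pi.single_eq_same]
    push_cast
    field_simp

theorem hasDerivAt_comp_line {f : (Fin p → ℝ) → ℝ} (hf : Differentiable ℝ f)
    (k w : Fin p → ℝ) (t : ℝ) :
    HasDerivAt (fun t : ℝ => f (k + t • w)) (∑ r, w r * partialDeriv r f (k + t • w)) t := by
  have h1 : HasDerivAt (fun t : ℝ => k + t • w) w t := by
    simpa using ((hasDerivAt_id t).smul_const w).const_add k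
  have h2 := (hf (k + t • w)).hasFDerivAt.comp_hasDerivAt t h1
  have h3 : fderiv ℝ f (k + t • w) w = ∑ r, w r * partialDeriv r f (k + t • w) := by
    rw [← (fderiv ℝ f (k + t • w)).sum_comp_single ℝ (fun _ => ℝ)]
    refine Finset.sum_congr rfl fun r _ => ?_
    rw [partialDeriv_eq_fderiv hf, ← smul_eq_mul, ← map_smul, ← Pi.single_smul]
    simp
  rwa [h3] at h2

theorem contDiff_comp_line {N : WithTop ℕ∞} {f : (Fin p → ℝ) → ℝ} (hf : ContDiff ℝ N f)
    (k w : Fin p → ℝ) : ContDiff ℝ N fun t : ℝ => f (k + t • w) :=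
  hf.comp (contDiff_const.add (contDiff_id.smul contDiff_const))

theorem iteratedDeriv_comp_line (d : ℕ) {f : (Fin p → ℝ) → ℝ}
    (hf : ContDiff ℝ (d : WithTop ℕ∞) f) (k w : Fin p → ℝ) (t : ℝ) :
    iteratedDeriv d (fun t : ℝ => f (k + t • w)) t =
      ∑ α ∈ ofDegree p d, (d.factorial : ℝ) / (∏ r, ((α r).factorial : ℝ)) *
        ((∏ r, w r ^ α r) * multiDeriv α f (k + t • w)) := by
  induction d generalizing f with
  | zero =>
    simp [ofDegree, multiDeriv_zero]
  | succ d ih =>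
    have hder : deriv (fun t : ℝ => f (k + t • w)) =
        fun t => ∑ r, w r * partialDeriv r f (k + t • w) :=
      funext fun t => (hasDerivAt_comp_line (hf.differentiable (by simp)) k w t).deriv
    have hpd : ∀ r, ContDiff ℝ (d : WithTop ℕ∞) (partialDeriv r f) :=
      contDiff_partialDeriv hf
    -- The innermost derivative is taken first, so that the induction hypothesis applies to each
    -- partial derivative of `f`.
    rw [iteratedDeriv_succ', hder, iteratedDeriv_fun_sum fun r _ =>
      (contDiff_const.mul (contDiff_comp_line (hpd r) k w)).contDiffAt]
    rw [← sum_ofDegree_add_single d fun α => (∏ r, w r ^ α r) * multiDeriv α f (k + t • w),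
      Finset.sum_comm]
    refine Finset.sum_congr rfl fun r _ => ?_
    rw [iteratedDeriv_const_mul_field, ih (hpd r), Finset.mul_sum]
    refine Finset.sum_congr rfl fun α hα => ?_
    rw [multiDeriv_partialDeriv α (by rwa [mem_ofDegree.1 hα, add_comm]),
      prod_add_single (fun s k => w s ^ k), pow_succ,
      ← Finset.mul_prod_erase Finset.univ (fun s => w s ^ α s) (Finset.mem_univ r)]
    ring

theorem taylor_multiDeriv {N : ℕ} {f : (Fin p → ℝ) → ℝ}
    (hf : ContDiff ℝ ((N + 1 : ℕ) : WithTop ℕ∞) f) (k w : Fin p → ℝ) :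
    f (k + w) =
      (∑ d ∈ Finset.range (N + 1), ∑ α ∈ ofDegree p d,
        1 / (∏ r, ((α r).factorial : ℝ)) * ((∏ r, w r ^ α r) * multiDeriv α f k)) +
      ∑ α ∈ ofDegree p (N + 1), (N + 1 : ℝ) / (∏ r, ((α r).factorial : ℝ)) * ((∏ r, w r ^ α r) *
        ∫ s in (0 : ℝ)..1, (1 - s) ^ N * multiDeriv α f (k + s • w)) := by
  have hg := contDiff_comp_line hf k w
  -- One-variable Taylor formula for t ↦ f(k + t w), from t = 0 to t = 1.
  have htay := taylor_integral_remainder (x := 1) (x₀ := 0) (n := N) hg.contDiffOn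
  have hu : UniqueDiffOn ℝ (Set.uIcc (0 : ℝ) 1) := uniqueDiffOn_uIcc (by norm_num)
  have hwithin : ∀ d ≤ N + 1, ∀ t ∈ Set.uIcc (0 : ℝ) 1,
      iteratedDerivWithin d (fun t : ℝ => f (k + t • w)) (Set.uIcc (0 : ℝ) 1) t =
      ∑ α ∈ ofDegree p d, (d.factorial : ℝ) / (∏ r, ((α r).factorial : ℝ)) *
        ((∏ r, w r ^ α r) * multiDeriv α f (k + t • w)) := by
    intro d hd t ht
    have hfd : ContDiff ℝ (d : WithTop ℕ∞) f := hf.of_le (by exact_mod_cast hd)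
    rw [iteratedDerivWithin_eq_iteratedDeriv hu (contDiff_comp_line hfd k w).contDiffAt ht,
      iteratedDeriv_comp_line d hfd]
  rw [taylor_within_apply] at htay
  simp only [one_smul] at htay
  rw [← sub_eq_iff_eq_add']
  convert htay using 2
  · refine Finset.sum_congr rfl fun d hd => ?_
    rw [Finset.mem_range] at hd
    rw [hwithin d (by omega) 0 Set.left_mem_uIcc, smul_eq_mul, Finset.mul_sum]
    refine Finset.sum_congr rfl fun α _ => ?_
    have : (d.factorial : ℝ) ≠ 0 := by positivity
    simp only [sub_zero, one_pow, mul_one, zero_smul, add_zero]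
    field_simp
  · have hcont : ∀ α ∈ ofDegree p (N + 1), Continuous (multiDeriv α f) := fun α hα =>
      continuous_multiDeriv α hf (mem_ofDegree.1 hα).le
    rw [intervalIntegral.integral_congr (g := fun t => ∑ α ∈ ofDegree p (N + 1),
      (N + 1 : ℝ) / (∏ r, ((α r).factorial : ℝ)) * ((∏ r, w r ^ α r) *
        ((1 - t) ^ N * multiDeriv α f (k + t • w))))]
    · rw [intervalIntegral.integral_finsetSum]
      · refine Finset.sum_congr rfl fun α _ => ?_
        rw [intervalIntegral.integral_const_mul, intervalIntegral.integral_const_mul]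
      · intro α hα
        have := hcont α hα
        exact Continuous.intervalIntegrable (by fun_prop) _ _
    · intro t ht
      simp only
      rw [hwithin (N + 1) le_rfl t ht, smul_eq_mul, Finset.mul_sum]
      refine Finset.sum_congr rfl fun α _ => ?_
      have : (N.factorial : ℝ) ≠ 0 := by positivity
      rw [Nat.factorial_succ]
      push_cast
      field_simp

end

/-! ### The summation formula -/

section

variable {p : ℕ}

/-- The cube `[-1, 1]^p`. -/
def cube (p : ℕ) : Set (Fin p → ℝ) := Set.Icc (fun _ => -1) (fun _ => 1)

theorem isCompact_cube : IsCompact (cube p) := isCompact_Icc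

theorem measurableSet_cube : MeasurableSet (cube p) := measurableSet_Icc

theorem cube_eq_pi : cube p = Set.univ.pi fun _ => Set.Icc (-1 : ℝ) 1 := by
  rw [Set.pi_univ_Icc]; rfl

theorem boxInt_of_le {u v : Fin p → ℝ} (h : u ≤ v) (f : (Fin p → ℝ) → ℝ) :
    boxInt u v f = ∫ x in Set.Icc u v, f x := by
  rw [boxInt, Finset.filter_false_of_mem fun r _ => not_lt.2 (h r), inf_of_le_left h,
    sup_of_le_right h]
  simp

theorem boxInt_cube (f : (Fin p → ℝ) → ℝ) :
    boxInt (fun _ => -1) (fun _ => 1) f = ∫ x in cube p, f x :=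
  boxInt_of_le (fun _ => by norm_num) f

theorem integrableOn_cube {f : (Fin p → ℝ) → ℝ} (hf : Continuous f) :
    IntegrableOn f (cube p) :=
  hf.continuousOn.integrableOn_compact isCompact_cube

/-- Change of variables by a diagonal matrix with determinant ∏ c r, after a translation by k. -/
theorem integral_eq_prod_mul_integral_comp_scale {c : Fin p → ℝ} (hc : ∀ r, 0 < c r)
    (k : Fin p → ℝ) {g : (Fin p → ℝ) → ℝ} (hg : Measurable g) :
    ∫ x, g x = (∏ r, c r) * ∫ x : Fin p → ℝ, g (fun r => k r + c r * x r) := by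
  have hprod : 0 < ∏ r, c r := Finset.prod_pos fun r _ => hc r
  have hdet : (Matrix.diagonal c).det = ∏ r, c r := Matrix.det_diagonal
  have hmap := Real.smul_map_diagonal_volume_pi (D := c) (by rw [hdet]; exact hprod.ne')
  have hmeas : Measurable (Matrix.toLin' (Matrix.diagonal c)) :=
    (LinearMap.continuous_on_pi _).measurable
  have hg' : Measurable fun x => g (k + x) := hg.comp (measurable_const_add k)
  rw [← integral_add_left_eq_self g k]
  conv_lhs => rw [← hmap]
  rw [integral_smul_measure, integral_map hmeas.aemeasurable hg'.aestronglyMeasurable, hdet,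
    abs_of_pos hprod, ENNReal.toReal_ofReal hprod.le, smul_eq_mul]
  congr 2 with x
  congr 1
  funext r
  simp [Matrix.mulVec_diagonal]

theorem boxInt_translate {j : Fin p → ℝ} (hj : ∀ r, 0 < j r) (k : Fin p → ℝ)
    {f : (Fin p → ℝ) → ℝ} (hf : Continuous f) :
    boxInt (fun r => k r - j r / 2) (fun r => k r + j r / 2) f =
      (∏ r, j r / 2) * ∫ v in cube p, f (fun r => k r + j r * v r / 2) := by
  rw [boxInt_of_le (fun r => by have := hj r; simp only; linarith),
    ← integral_indicator measurableSet_Icc,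
    integral_eq_prod_mul_integral_comp_scale (c := fun r => j r / 2)
      (fun r => half_pos (hj r)) k (hf.measurable.indicator measurableSet_Icc),
    ← integral_indicator measurableSet_cube]
  congr 2 with v
  have hmem : (fun r => k r + j r / 2 * v r) ∈
      Set.Icc (fun r => k r - j r / 2) (fun r => k r + j r / 2) ↔ v ∈ cube p := by
    simp only [cube, Set.mem_Icc, Pi.le_def]
    refine and_congr (forall_congr' fun r => ?_) (forall_congr' fun r => ?_)
    · have := hj r
      constructor <;> intro h <;> nlinarith
    · have := hj r
      constructor <;> intro h <;> nlinarith
  have hval : (fun r => k r + j r / 2 * v r) = fun r => k r + j r * v r / 2 := by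
    funext r; ring
  by_cases h : v ∈ cube p
  · rw [Set.indicator_of_mem h, Set.indicator_of_mem (hmem.2 h), hval]
  · rw [Set.indicator_of_notMem h, Set.indicator_of_notMem (mt hmem.1 h)]

theorem integral_cube_prod (g : Fin p → ℝ → ℝ) :
    ∫ v in cube p, ∏ r, g r (v r) = ∏ r, ∫ x in (-1 : ℝ)..1, g r x := by
  rw [cube_eq_pi, volume_pi, Measure.restrict_pi_pi, integral_fintype_prod_eq_prod]
  refine Finset.prod_congr rfl fun r _ => ?_
  rw [intervalIntegral.integral_of_le (by norm_num), integral_Icc_eq_integral_Ioc]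

/-- Odd powers integrate to zero. An even power e = 2l contributes a constant times j^(2l+1), and e
< 2m is exactly the range l < m in which the moment identity holds. -/
theorem sum_gam_mul_integral_pow {m e : ℕ} (he : e < 2 * m) :
    ∑ j ∈ Finset.Icc 1 m, gam m j * ((j : ℝ) / 2 * ∫ x in (-1 : ℝ)..1, ((j : ℝ) * x / 2) ^ e) =
      if e = 0 then 1 else 0 := by
  have hint : ∀ j : ℕ, ∫ x in (-1 : ℝ)..1, ((j : ℝ) * x / 2) ^ e =
      ((j : ℝ) / 2) ^ e * ((1 - (-1) ^ (e + 1)) / (e + 1)) := by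
    intro j
    have : ∀ x : ℝ, ((j : ℝ) * x / 2) ^ e = ((j : ℝ) / 2) ^ e * x ^ e := fun x => by
      rw [← mul_pow]; ring
    simp only [this, intervalIntegral.integral_const_mul, integral_pow, one_pow]
  simp only [hint]
  rcases Nat.even_or_odd' e with ⟨l, rfl | rfl⟩
  · have hterm : ∀ j ∈ Finset.Icc 1 m, gam m j * ((j : ℝ) / 2 * (((j : ℝ) / 2) ^ (2 * l) *
        ((1 - (-1) ^ (2 * l + 1)) / (((2 * l : ℕ) : ℝ) + 1)))) =
        1 / (2 ^ (2 * l) * (2 * l + 1)) * (gam m j * (j : ℝ) ^ (2 * l + 1)) := by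
      intro j _
      have h1 : (-1 : ℝ) ^ (2 * l + 1) = -1 := Odd.neg_one_pow ⟨l, rfl⟩
      have h2 : (2 * (l : ℝ) + 1) ≠ 0 := by positivity
      rw [h1, div_pow]
      push_cast
      field_simp
      ring
    rw [Finset.sum_congr rfl hterm, ← Finset.mul_sum, sum_gam_mul_pow (by omega)]
    rcases Nat.eq_zero_or_pos l with rfl | hl
    · simp
    · simp [hl.ne']
  · have h1 : (-1 : ℝ) ^ (2 * l + 1 + 1) = 1 := Even.neg_one_pow ⟨l + 1, by ring⟩
    simp [h1]

theorem sum_gamVec_mul_integral_monomial {m : ℕ} (α : Fin p → ℕ) (hα : ∑ r, α r < 2 * m) :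
    ∑ j ∈ upTo p m, gamVec m j * ((∏ r, (j r : ℝ) / 2) *
      ∫ v in cube p, ∏ r, ((j r : ℝ) * v r / 2) ^ α r) = if α = 0 then 1 else 0 := by
  have h1 : ∀ j : Fin p → ℕ, (∏ r, (j r : ℝ) / 2) *
      ∫ v in cube p, ∏ r, ((j r : ℝ) * v r / 2) ^ α r =
      ∏ r, ((j r : ℝ) / 2 * ∫ x in (-1 : ℝ)..1, ((j r : ℝ) * x / 2) ^ α r) := by
    intro j
    rw [integral_cube_prod fun r x => ((j r : ℝ) * x / 2) ^ α r, Finset.prod_mul_distrib]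
  simp only [h1]
  rw [sum_gamVec_mul_prod m fun r j => (j : ℝ) / 2 * ∫ x in (-1 : ℝ)..1, ((j : ℝ) * x / 2) ^ α r]
  have h2 : ∀ r, α r < 2 * m := fun r =>
    lt_of_le_of_lt (Finset.single_le_sum (f := α) (fun _ _ => Nat.zero_le _) (Finset.mem_univ r)) hα
  simp only [fun r => sum_gam_mul_integral_pow (h2 r)]
  split_ifs with h
  · simp [h]
  · obtain ⟨r, hr⟩ := Function.ne_iff.1 h
    exact Finset.prod_eq_zero (Finset.mem_univ r) (if_neg hr)

/-- The integral over the segment parameter in the Taylor remainder of `f` at `k`, with the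
increment `j v / 2`. -/
noncomputable def segInt (m : ℕ) (f : (Fin p → ℝ) → ℝ) (α k j : Fin p → ℕ) (v : Fin p → ℝ) : ℝ :=
  ∫ s in (0 : ℝ)..1, (1 - s) ^ (2 * m - 1) *
    multiDeriv α f (fun r => (k r : ℝ) + s * (j r : ℝ) * v r / 2)

variable {m : ℕ} {f : (Fin p → ℝ) → ℝ}

theorem continuous_segInt (hf : ContDiff ℝ ((2 * m : ℕ) : WithTop ℕ∞) f) {α : Fin p → ℕ}
    (hα : ∑ r, α r = 2 * m) (k j : Fin p → ℕ) : Continuous (segInt m f α k j) := by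
  have hc := continuous_multiDeriv α hf hα.le
  unfold segInt
  refine intervalIntegral.continuous_parametric_intervalIntegral_of_continuous' ?_ 0 1
  simp only [Function.uncurry_def]
  fun_prop

theorem taylor_translate (hm : 1 ≤ m) (hf : ContDiff ℝ ((2 * m : ℕ) : WithTop ℕ∞) f)
    (k j : Fin p → ℕ) (v : Fin p → ℝ) :
    f (fun r => (k r : ℝ) + (j r : ℝ) * v r / 2) =
      (∑ d ∈ Finset.range (2 * m), ∑ α ∈ ofDegree p d,
        (1 / (∏ r, ((α r).factorial : ℝ)) * multiDeriv α f (fun r => (k r : ℝ))) *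
          ∏ r, ((j r : ℝ) * v r / 2) ^ α r) +
      ∑ α ∈ ofDegree p (2 * m), (2 * m : ℝ) / (∏ r, ((α r).factorial : ℝ)) *
        ((∏ r, ((j r : ℝ) * v r / 2) ^ α r) * segInt m f α k j v) := by
  obtain ⟨N, hN⟩ : ∃ N, 2 * m = N + 1 := ⟨2 * m - 1, by omega⟩
  have hNm : (2 * m : ℝ) = (N + 1 : ℝ) := by exact_mod_cast hN
  have hN' : 2 * m - 1 = N := by omega
  simp only [segInt, hN']
  rw [hN] at hf ⊢
  rw [hNm]
  have h := taylor_multiDeriv hf (fun r => (k r : ℝ)) (fun r => (j r : ℝ) * v r / 2)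
  have harg : ∀ s : ℝ, ((fun r => (k r : ℝ)) + s • fun r => (j r : ℝ) * v r / 2) =
      fun r => (k r : ℝ) + s * (j r : ℝ) * v r / 2 := by
    intro s
    funext r
    simp only [Pi.add_apply, Pi.smul_apply, smul_eq_mul]
    ring
  simp only [harg] at h
  refine h.trans ?_
  congr 1
  refine Finset.sum_congr rfl fun d _ => Finset.sum_congr rfl fun α _ => ?_
  ring

theorem integral_translate (hm : 1 ≤ m) (hf : ContDiff ℝ ((2 * m : ℕ) : WithTop ℕ∞) f)
    (k j : Fin p → ℕ) :
    ∫ v in cube p, f (fun r => (k r : ℝ) + (j r : ℝ) * v r / 2) =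
      (∑ d ∈ Finset.range (2 * m), ∑ α ∈ ofDegree p d,
        (1 / (∏ r, ((α r).factorial : ℝ)) * multiDeriv α f (fun r => (k r : ℝ))) *
          ∫ v in cube p, ∏ r, ((j r : ℝ) * v r / 2) ^ α r) +
      ∑ α ∈ ofDegree p (2 * m), (2 * m : ℝ) / (∏ r, ((α r).factorial : ℝ)) *
        ∫ v in cube p, (∏ r, ((j r : ℝ) * v r / 2) ^ α r) * segInt m f α k j v := by
  have hmon : ∀ α : Fin p → ℕ, Continuous fun v : Fin p → ℝ =>
      ∏ r, ((j r : ℝ) * v r / 2) ^ α r := fun α => by fun_prop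
  have hi1 : ∀ α : Fin p → ℕ, ∀ c : ℝ, IntegrableOn (fun v : Fin p → ℝ =>
      c * ∏ r, ((j r : ℝ) * v r / 2) ^ α r) (cube p) := fun α c =>
    integrableOn_cube ((hmon α).const_mul c)
  have hi2 : ∀ α ∈ ofDegree p (2 * m), ∀ c : ℝ, IntegrableOn (fun v : Fin p → ℝ =>
      c * ((∏ r, ((j r : ℝ) * v r / 2) ^ α r) * segInt m f α k j v)) (cube p) := fun α hα c =>
    integrableOn_cube
      (((hmon α).mul (continuous_segInt hf (mem_ofDegree.1 hα) k j)).const_mul c)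
  simp only [taylor_translate hm hf]
  rw [integral_add
    (integrable_finsetSum _ fun d _ => integrable_finsetSum _ fun α _ => hi1 α _)
    (integrable_finsetSum _ fun α hα => hi2 α hα _),
    integral_finsetSum _ (fun d _ => integrable_finsetSum _ fun α _ => hi1 α _),
    integral_finsetSum _ (fun α hα => hi2 α hα _)]
  congr 1
  · refine Finset.sum_congr rfl fun d _ => ?_
    rw [integral_finsetSum _ (fun α _ => hi1 α _)]
    exact Finset.sum_congr rfl fun α _ => integral_const_mul _ _
  · exact Finset.sum_congr rfl fun α _ => integral_const_mul _ _

theorem sum_gamVec_mul_integral_translate (hm : 1 ≤ m)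
    (hf : ContDiff ℝ ((2 * m : ℕ) : WithTop ℕ∞) f) (k : Fin p → ℕ) :
    ∑ j ∈ upTo p m, gamVec m j * ((∏ r, (j r : ℝ) / 2) *
        ∫ v in cube p, f (fun r => (k r : ℝ) + (j r : ℝ) * v r / 2)) =
      f (fun r => (k r : ℝ)) + ∑ j ∈ upTo p m, gamVec m j * ((∏ r, (j r : ℝ) / 2) *
        ∑ α ∈ ofDegree p (2 * m), (2 * m : ℝ) / (∏ r, ((α r).factorial : ℝ)) *
          ∫ v in cube p, (∏ r, ((j r : ℝ) * v r / 2) ^ α r) * segInt m f α k j v) := by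
  simp only [integral_translate hm hf, mul_add, Finset.sum_add_distrib]
  congr 1
  simp only [Finset.mul_sum]
  rw [Finset.sum_comm]
  have hd : ∀ d ∈ Finset.range (2 * m), ∑ j ∈ upTo p m, ∑ α ∈ ofDegree p d,
      gamVec m j * ((∏ r, (j r : ℝ) / 2) *
        ((1 / (∏ r, ((α r).factorial : ℝ)) * multiDeriv α f (fun r => (k r : ℝ))) *
          ∫ v in cube p, ∏ r, ((j r : ℝ) * v r / 2) ^ α r)) =
      if d = 0 then f (fun r => (k r : ℝ)) else 0 := by
    intro d hd
    rw [Finset.mem_range] at hd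
    rw [Finset.sum_comm]
    have hα : ∀ α ∈ ofDegree p d, ∑ j ∈ upTo p m,
        gamVec m j * ((∏ r, (j r : ℝ) / 2) *
        ((1 / (∏ r, ((α r).factorial : ℝ)) * multiDeriv α f (fun r => (k r : ℝ))) *
          ∫ v in cube p, ∏ r, ((j r : ℝ) * v r / 2) ^ α r)) =
        if α = 0 then f (fun r => (k r : ℝ)) else 0 := by
      intro α hα
      have hs := sum_gamVec_mul_integral_monomial (m := m) α (by rw [mem_ofDegree.1 hα]; exact hd)
      calc _ = (1 / (∏ r, ((α r).factorial : ℝ)) * multiDeriv α f (fun r => (k r : ℝ))) *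
            ∑ j ∈ upTo p m, gamVec m j * ((∏ r, (j r : ℝ) / 2) *
              ∫ v in cube p, ∏ r, ((j r : ℝ) * v r / 2) ^ α r) := by
            rw [Finset.mul_sum]
            exact Finset.sum_congr rfl fun j _ => by ring
        _ = _ := by
            rw [hs]
            split_ifs with h
            · simp [h, multiDeriv_zero]
            · simp
    rw [Finset.sum_congr rfl hα]
    split_ifs with h
    · subst h
      simp [ofDegree]
    · refine Finset.sum_eq_zero fun α hα => if_neg ?_
      rintro rfl
      exact h (by simpa using (mem_ofDegree.1 hα).symm)
  -- Of all Taylor terms of degree below 2m only the constant one survives.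
  rw [Finset.sum_congr rfl hd, Finset.sum_ite_eq']
  simp [show 0 < m by omega]

theorem integral_swap_cube {F : ℝ → (Fin p → ℝ) → ℝ} (hF : Continuous (Function.uncurry F)) :
    ∫ s in (0 : ℝ)..1, ∫ v in cube p, F s v = ∫ v in cube p, ∫ s in (0 : ℝ)..1, F s v := by
  refine intervalIntegral_integral_swap ?_
  rw [Measure.prod_restrict, Set.uIoc_of_le zero_le_one]
  exact (hF.continuousOn.integrableOn_compact
    (isCompact_Icc.prod (isCompact_cube (p := p)))).mono_set
      (Set.prod_mono Set.Ioc_subset_Icc_self subset_rfl)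

theorem remainder_eq_sum (hp : 1 ≤ p) (n : Fin p → ℕ)
    (hf : ContDiff ℝ ((2 * m : ℕ) : WithTop ℕ∞) f) :
    remainder m n f = ∑ j ∈ upTo p m, gamVec m j * ∑ k ∈ below n, ((∏ r, (j r : ℝ) / 2) *
        ∑ α ∈ ofDegree p (2 * m), (2 * m : ℝ) / (∏ r, ((α r).factorial : ℝ)) *
          ∫ v in cube p, (∏ r, ((j r : ℝ) * v r / 2) ^ α r) * segInt m f α k j v) := by
  have hα : ∀ α ∈ ofDegree p (2 * m), (∫ s in (0 : ℝ)..1, (1 - s) ^ (2 * m - 1) *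
        boxInt (fun _ => -1) (fun _ => 1) (fun v =>
          (∏ r, v r ^ α r) *
            ∑ j ∈ upTo p m, gamVec m j * (∏ r, (j r : ℝ) ^ (α r + 1)) *
              ∑ k ∈ below n, multiDeriv α f (fun r => (k r : ℝ) + s * (j r : ℝ) * v r / 2))) =
      ∑ j ∈ upTo p m, ∑ k ∈ below n, gamVec m j * (∏ r, (j r : ℝ) ^ (α r + 1)) *
        ∫ v in cube p, (∏ r, v r ^ α r) * segInt m f α k j v := by
    intro α hα
    have hc := continuous_multiDeriv α hf (mem_ofDegree.1 hα).le
    have hseg := fun k j => continuous_segInt hf (mem_ofDegree.1 hα) k j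
    simp only [boxInt_cube, ← integral_const_mul]
    -- `remainder` integrates over s outside and v inside, whereas `segInt` has the integral over s
    -- inside.
    rw [integral_swap_cube (by simp only [Function.uncurry_def]; fun_prop)]
    have hinner : ∀ v : Fin p → ℝ, (∫ s in (0 : ℝ)..1, (1 - s) ^ (2 * m - 1) * ((∏ r, v r ^ α r) *
            ∑ j ∈ upTo p m, gamVec m j * (∏ r, (j r : ℝ) ^ (α r + 1)) *
              ∑ k ∈ below n, multiDeriv α f (fun r => (k r : ℝ) + s * (j r : ℝ) * v r / 2))) =
        ∑ j ∈ upTo p m, ∑ k ∈ below n, gamVec m j * (∏ r, (j r : ℝ) ^ (α r + 1)) *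
          ((∏ r, v r ^ α r) * segInt m f α k j v) := by
      intro v
      have hi : ∀ (j k : Fin p → ℕ), IntervalIntegrable (fun s : ℝ =>
          (gamVec m j * (∏ r, (j r : ℝ) ^ (α r + 1)) * (∏ r, v r ^ α r)) *
            ((1 - s) ^ (2 * m - 1) *
              multiDeriv α f (fun r => (k r : ℝ) + s * (j r : ℝ) * v r / 2))) volume 0 1 :=
        fun j k => Continuous.intervalIntegrable (by fun_prop) _ _
      calc _ = ∫ s in (0 : ℝ)..1, ∑ j ∈ upTo p m, ∑ k ∈ below n,
          (gamVec m j * (∏ r, (j r : ℝ) ^ (α r + 1)) * (∏ r, v r ^ α r)) *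
            ((1 - s) ^ (2 * m - 1) *
              multiDeriv α f (fun r => (k r : ℝ) + s * (j r : ℝ) * v r / 2)) := by
            congr 1 with s
            simp only [Finset.mul_sum]
            exact Finset.sum_congr rfl fun j _ => Finset.sum_congr rfl fun k _ => by ring
        _ = _ := by
            rw [intervalIntegral.integral_finsetSum fun j _ =>
              Continuous.intervalIntegrable (by fun_prop) _ _]
            refine Finset.sum_congr rfl fun j _ => ?_
            rw [intervalIntegral.integral_finsetSum fun k _ => hi j k]
            refine Finset.sum_congr rfl fun k _ => ?_
            rw [intervalIntegral.integral_const_mul, segInt, mul_assoc]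
    simp only [hinner]
    have hi : ∀ (j k : Fin p → ℕ), IntegrableOn (fun v : Fin p → ℝ =>
        gamVec m j * (∏ r, (j r : ℝ) ^ (α r + 1)) *
          ((∏ r, v r ^ α r) * segInt m f α k j v)) (cube p) := fun j k =>
      integrableOn_cube (by have := hseg k j; fun_prop)
    rw [integral_finsetSum _ fun j _ => integrable_finsetSum _ fun k _ => hi j k]
    refine Finset.sum_congr rfl fun j _ => ?_
    rw [integral_finsetSum _ fun k _ => hi j k]
  rw [remainder, Finset.sum_congr rfl fun α h => congrArg _ (hα α h)]
  simp only [Finset.mul_sum]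
  rw [Finset.sum_comm]
  refine Finset.sum_congr rfl fun j _ => ?_
  rw [Finset.sum_comm]
  refine Finset.sum_congr rfl fun k _ => Finset.sum_congr rfl fun α h => ?_
  have hpow : ∀ v : Fin p → ℝ, (∏ r, ((j r : ℝ) * v r / 2) ^ α r) * segInt m f α k j v =
      (∏ r, ((j r : ℝ) / 2) ^ α r) * ((∏ r, v r ^ α r) * segInt m f α k j v) := by
    intro v
    rw [← mul_assoc, ← Finset.prod_mul_distrib]
    congr 1
    exact Finset.prod_congr rfl fun r _ => by rw [← mul_pow]; ring
  simp only [hpow]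
  rw [integral_const_mul]
  have hconst : (∏ r, (j r : ℝ) / 2) * (∏ r, ((j r : ℝ) / 2) ^ α r) =
      (∏ r, (j r : ℝ) ^ (α r + 1)) / 2 ^ (2 * m + p) := by
    rw [← Finset.prod_mul_distrib]
    have : ∀ r, (j r : ℝ) / 2 * ((j r : ℝ) / 2) ^ α r = (j r : ℝ) ^ (α r + 1) / 2 ^ (α r + 1) :=
      fun r => by rw [← pow_succ', div_pow]
    simp only [this]
    rw [Finset.prod_div_distrib, Finset.prod_pow_eq_pow_sum, Finset.sum_add_distrib,
      mem_ofDegree.1 h]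
    simp
  -- The truncated subtraction in 2m + p - 1 is harmless since p ≥ 1; the spare factor 2 turns the
  -- Taylor constant 2m into the m of `remainder`.
  have h2 : (2 : ℝ) ^ (2 * m + p) = 2 ^ (2 * m + p - 1) * 2 := by
    rw [← pow_succ]; congr 1; omega
  rw [h2] at hconst
  set I := ∫ v in cube p, (∏ r, v r ^ α r) * segInt m f α k j v
  calc _ = gamVec m j * (((∏ r, (j r : ℝ) ^ (α r + 1)) / (2 ^ (2 * m + p - 1) * 2)) *
        ((2 * m : ℝ) / (∏ r, ((α r).factorial : ℝ)) * I)) := by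
        field_simp
    _ = _ := by
        rw [← hconst]; ring

theorem sum_eq_approx_sub_remainder (hp : 1 ≤ p) (hm : 1 ≤ m) (n : Fin p → ℕ)
    (hf : ContDiff ℝ ((2 * m : ℕ) : WithTop ℕ∞) f) :
    ∑ k ∈ below n, f (fun r => (k r : ℝ)) = approx m n f - remainder m n f := by
  rw [approx_eq_sum_translates m n hf.continuous, remainder_eq_sum hp n hf, eq_sub_iff_add_eq]
  simp only [Finset.mul_sum (below n)]
  rw [Finset.sum_comm, Finset.sum_comm (s := upTo p m), ← Finset.sum_add_distrib]
  refine Finset.sum_congr rfl fun k _ => ?_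
  rw [← sum_gamVec_mul_integral_translate hm hf k]
  refine Finset.sum_congr rfl fun j hj => ?_
  have hj' : ∀ r, 0 < (j r : ℝ) := fun r => by
    rw [upTo_eq, Fintype.mem_piFinset] at hj
    have := Finset.mem_Icc.1 (hj r)
    exact_mod_cast this.1
  rw [boxInt_translate hj' (fun r => (k r : ℝ)) hf.continuous]

end

/-! ### The bound on the remainder -/

section

variable {p m : ℕ} {f : (Fin p → ℝ) → ℝ}

theorem integral_abs_pow (e : ℕ) : ∫ x in (-1 : ℝ)..1, |x| ^ e = 2 / (e + 1) := by
  have hi : ∀ a b : ℝ, IntervalIntegrable (fun x : ℝ => |x| ^ e) volume a b := fun a b =>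
    Continuous.intervalIntegrable (by fun_prop) _ _
  have hpos : ∫ x in (0 : ℝ)..1, |x| ^ e = 1 / (e + 1) := by
    rw [intervalIntegral.integral_congr (g := fun x : ℝ => x ^ e)]
    · simp [integral_pow]
    · intro x hx
      rw [Set.uIcc_of_le zero_le_one] at hx
      simp [abs_of_nonneg hx.1]
  have hneg : ∫ x in (-1 : ℝ)..0, |x| ^ e = 1 / (e + 1) := by
    have := intervalIntegral.integral_comp_neg (a := 0) (b := 1) fun x : ℝ => |x| ^ e
    simp only [abs_neg, neg_zero] at this
    rw [← this, hpos]
  rw [← intervalIntegral.integral_add_adjacent_intervals (hi (-1) 0) (hi 0 1), hpos, hneg]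
  ring

/-- The hypothesis concerns a half-open box, while s j v / 2 ranges over the closed one; continuity
carries the bound to the closure, and m ≥ 1 makes the intervals nondegenerate. -/
theorem abs_sum_le_on_closed_box (hm : 1 ≤ m) {g : (Fin p → ℝ) → ℝ} (hg : Continuous g) {M : ℝ}
    (hM : ∀ u : Fin p → ℝ, (∀ r, -(m : ℝ) / 2 < u r ∧ u r ≤ (m : ℝ) / 2) → |g u| ≤ M)
    {u : Fin p → ℝ} (hu : ∀ r, -(m : ℝ) / 2 ≤ u r ∧ u r ≤ (m : ℝ) / 2) : |g u| ≤ M := by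
  have hcl : IsClosed {u | |g u| ≤ M} := isClosed_le hg.abs continuous_const
  have hsub : (Set.univ.pi fun _ : Fin p => Set.Ioc (-(m : ℝ) / 2) ((m : ℝ) / 2)) ⊆
      {u | |g u| ≤ M} := fun u hu => hM u fun r => hu r (Set.mem_univ r)
  refine closure_minimal hsub hcl ?_
  have hm' : (1 : ℝ) ≤ m := by exact_mod_cast hm
  rw [closure_pi_set]
  intro r _
  rw [closure_Ioc (by linarith)]
  exact hu r

theorem abs_remainder_le (hp : 1 ≤ p) (hm : 1 ≤ m) (n : Fin p → ℕ)
    (hf : ContDiff ℝ ((2 * m : ℕ) : WithTop ℕ∞) f) {M : ℝ}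
    (hM : ∀ α : Fin p → ℕ, ∑ r, α r = 2 * m →
        ∀ u : Fin p → ℝ, (∀ r, -(m : ℝ) / 2 < u r ∧ u r ≤ (m : ℝ) / 2) →
          |∑ k ∈ below n, multiDeriv α f (fun r => (k r : ℝ) + u r)| ≤ M) :
    |remainder m n f| ≤ remainderBound p m M := by
  have hm0 : (0 : ℝ) < m := by exact_mod_cast hm
  set K : (Fin p → ℕ) → ℝ := fun α =>
    ∑ j ∈ upTo p m, |gamVec m j| * ∏ r, (j r : ℝ) ^ (α r + 1) with hK
  have hsum : ∀ α ∈ ofDegree p (2 * m), ∀ s ∈ Set.Icc (0 : ℝ) 1, ∀ v ∈ cube p, ∀ j ∈ upTo p m,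
      |∑ k ∈ below n, multiDeriv α f (fun r => (k r : ℝ) + s * (j r : ℝ) * v r / 2)| ≤ M := by
    intro α hα s hs v hv j hj
    have hc := continuous_multiDeriv α hf (mem_ofDegree.1 hα).le
    have := abs_sum_le_on_closed_box hm
      (g := fun u => ∑ k ∈ below n, multiDeriv α f (fun r => (k r : ℝ) + u r)) (by fun_prop)
      (hM α (mem_ofDegree.1 hα)) (u := fun r => s * (j r : ℝ) * v r / 2) fun r => ?_
    · exact this
    · rw [upTo_eq, Fintype.mem_piFinset] at hj
      have hj2 : (j r : ℝ) ≤ m := by exact_mod_cast (Finset.mem_Icc.1 (hj r)).2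
      have hv1 : |v r| ≤ 1 := abs_le.2 ⟨hv.1 r, hv.2 r⟩
      have habs : |s * (j r : ℝ) * v r| ≤ m := by
        rw [abs_mul, abs_mul, abs_of_nonneg hs.1, Nat.abs_cast]
        calc s * (j r : ℝ) * |v r| ≤ 1 * m * 1 := by
              gcongr
              exact hs.2
          _ = m := by ring
      have := abs_le.1 habs
      constructor <;> linarith
  have hbox : ∀ α ∈ ofDegree p (2 * m), ∀ s ∈ Set.Icc (0 : ℝ) 1,
      |boxInt (fun _ => -1) (fun _ => 1) (fun v : Fin p → ℝ =>
          (∏ r, v r ^ α r) *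
            ∑ j ∈ upTo p m, gamVec m j * (∏ r, (j r : ℝ) ^ (α r + 1)) *
              ∑ k ∈ below n, multiDeriv α f (fun r => (k r : ℝ) + s * (j r : ℝ) * v r / 2))| ≤
        (∏ r, 2 / ((α r : ℝ) + 1)) * (K α * M) := by
    intro α hα s hs
    rw [boxInt_cube]
    have hint : ∫ v in cube p, (∏ r, |v r| ^ α r) * (K α * M) =
        (∏ r, 2 / ((α r : ℝ) + 1)) * (K α * M) := by
      rw [integral_mul_const, integral_cube_prod fun r x => |x| ^ α r]
      simp only [integral_abs_pow]
    rw [← hint, ← Real.norm_eq_abs]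
    refine norm_integral_le_of_norm_le
      (integrableOn_cube (f := fun v => (∏ r, |v r| ^ α r) * (K α * M))
        (by fun_prop)) ?_
    refine (ae_restrict_iff' measurableSet_cube).2 (Filter.Eventually.of_forall fun v hv => ?_)
    rw [Real.norm_eq_abs, abs_mul, Finset.abs_prod]
    simp only [abs_pow]
    refine mul_le_mul_of_nonneg_left ?_ (Finset.prod_nonneg fun r _ => by positivity)
    rw [hK, Finset.sum_mul]
    refine (Finset.abs_sum_le_sum_abs _ _).trans (Finset.sum_le_sum fun j hj => ?_)
    have hpos : (0 : ℝ) ≤ ∏ r, (j r : ℝ) ^ (α r + 1) :=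
      Finset.prod_nonneg fun r _ => by positivity
    rw [abs_mul, abs_mul, abs_of_nonneg hpos]
    exact mul_le_mul_of_nonneg_left (hsum α hα s hs v hv j hj) (by positivity)
  have hseg : ∀ α ∈ ofDegree p (2 * m), |∫ s in (0 : ℝ)..1, (1 - s) ^ (2 * m - 1) *
        boxInt (fun _ => -1) (fun _ => 1) (fun v : Fin p → ℝ =>
          (∏ r, v r ^ α r) *
            ∑ j ∈ upTo p m, gamVec m j * (∏ r, (j r : ℝ) ^ (α r + 1)) *
              ∑ k ∈ below n, multiDeriv α f (fun r => (k r : ℝ) + s * (j r : ℝ) * v r / 2))| ≤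
        1 / (2 * m) * ((∏ r, 2 / ((α r : ℝ) + 1)) * (K α * M)) := by
    intro α hα
    have hint : ∫ s in (0 : ℝ)..1, (1 - s) ^ (2 * m - 1) *
        ((∏ r, 2 / ((α r : ℝ) + 1)) * (K α * M)) =
        1 / (2 * m) * ((∏ r, 2 / ((α r : ℝ) + 1)) * (K α * M)) := by
      rw [intervalIntegral.integral_mul_const]
      congr 1
      rw [intervalIntegral.integral_comp_sub_left (fun x : ℝ => x ^ (2 * m - 1)), integral_pow]
      have : ((2 * m - 1 : ℕ) : ℝ) + 1 = 2 * m := by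
        have h : 2 * m - 1 + 1 = 2 * m := by omega
        exact_mod_cast h
      rw [this]
      simp
    rw [← hint, ← Real.norm_eq_abs]
    refine intervalIntegral.norm_integral_le_of_norm_le zero_le_one
      (Filter.Eventually.of_forall fun s hs => ?_)
      (Continuous.intervalIntegrable (by fun_prop) _ _)
    have hnn : (0 : ℝ) ≤ (1 - s) ^ (2 * m - 1) := pow_nonneg (by linarith [hs.2]) _
    rw [Real.norm_eq_abs, abs_mul, abs_of_nonneg hnn]
    exact mul_le_mul_of_nonneg_left (hbox α hα s ⟨hs.1.le, hs.2⟩) hnn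
  rw [remainder, remainderBound, abs_mul, abs_of_nonneg (by positivity)]
  have hle : |∑ α ∈ ofDegree p (2 * m), 1 / (∏ r, ((α r).factorial : ℝ)) *
      ∫ s in (0 : ℝ)..1, (1 - s) ^ (2 * m - 1) *
        boxInt (fun _ => -1) (fun _ => 1) (fun v : Fin p → ℝ =>
          (∏ r, v r ^ α r) *
            ∑ j ∈ upTo p m, gamVec m j * (∏ r, (j r : ℝ) ^ (α r + 1)) *
              ∑ k ∈ below n, multiDeriv α f (fun r => (k r : ℝ) + s * (j r : ℝ) * v r / 2))| ≤
      ∑ α ∈ ofDegree p (2 * m), 1 / (∏ r, ((α r).factorial : ℝ)) *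
        (1 / (2 * m) * ((∏ r, 2 / ((α r : ℝ) + 1)) * (K α * M))) := by
    refine (Finset.abs_sum_le_sum_abs _ _).trans (Finset.sum_le_sum fun α hα => ?_)
    have hpos : (0 : ℝ) ≤ 1 / (∏ r, ((α r).factorial : ℝ)) := by positivity
    rw [abs_mul, abs_of_nonneg hpos]
    exact mul_le_mul_of_nonneg_left (hseg α hα) hpos
  -- The integral over s gives 1/(2m) and the one over v gives 2^p / ∏ (α_r + 1); together they
  -- reduce m / 2^(2m+p-1) to 1 / 2^(2m) and α! to (α + 1)!.
  refine (mul_le_mul_of_nonneg_left hle (by positivity)).trans_eq ?_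
  rw [Finset.mul_sum, Finset.mul_sum]
  refine Finset.sum_congr rfl fun α _ => ?_
  have hfac : (∏ r, ((α r + 1).factorial : ℝ)) =
      (∏ r, ((α r : ℝ) + 1)) * ∏ r, ((α r).factorial : ℝ) := by
    rw [← Finset.prod_mul_distrib]
    exact Finset.prod_congr rfl fun r _ => by rw [Nat.factorial_succ]; push_cast; rfl
  have hp2 : (2 : ℝ) ^ (2 * m + p - 1) * 2 = 2 ^ (2 * m) * 2 ^ p := by
    rw [← pow_succ, ← pow_add]; congr 1; omega
  have h1 : (∏ r, ((α r : ℝ) + 1)) ≠ 0 := Finset.prod_ne_zero_iff.2 fun r _ => by positivity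
  have h2 : (∏ r, ((α r).factorial : ℝ)) ≠ 0 := Finset.prod_ne_zero_iff.2 fun r _ => by positivity
  rw [Finset.prod_div_distrib, Finset.prod_const, Finset.card_univ, Fintype.card_fin, hfac]
  change _ = M / 2 ^ (2 * m) * (1 / ((∏ r, ((α r : ℝ) + 1)) * ∏ r, ((α r).factorial : ℝ)) * K α)
  set X := (2 : ℝ) ^ (2 * m + p - 1) with hX
  have hXne : X ≠ 0 := by positivity
  have hY : (2 : ℝ) ^ p = X * 2 / 2 ^ (2 * m) := by
    rw [hp2]; field_simp
  rw [hY]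
  field_simp

end

/-! ### The constant `Λ_*` -/

/-- The logarithm of `Λ`. -/
noncomputable def logLam (t : ℝ) : ℝ :=
  (t - 1) * Real.log (1 - t) - (1 + t) * Real.log (1 + t) + 2 * Real.log t

/-- The logarithmic derivative of `Λ`. -/
noncomputable def dlogLam (t : ℝ) : ℝ := Real.log (1 - t) - Real.log (1 + t) + 2 / t

theorem Lam_eq_exp {t : ℝ} (ht : t ∈ Set.Ioo (0 : ℝ) 1) : Lam t = Real.exp (logLam t) := by
  have h1 : 0 < 1 - t := by linarith [ht.2]
  have h2 : 0 < 1 + t := by linarith [ht.1]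
  rw [Lam, logLam, Real.exp_add, Real.exp_sub, Real.rpow_def_of_pos h1, Real.rpow_def_of_pos h2,
    two_mul, Real.exp_add, Real.exp_log ht.1, div_eq_mul_inv, ← Real.exp_neg, sq]
  ring_nf

theorem Lam_pos {t : ℝ} (ht : t ∈ Set.Ioo (0 : ℝ) 1) : 0 < Lam t := by
  rw [Lam_eq_exp ht]; exact Real.exp_pos _

theorem hasDerivAt_logLam {t : ℝ} (ht : t ∈ Set.Ioo (0 : ℝ) 1) :
    HasDerivAt logLam (dlogLam t) t := by
  have h1 : 1 - t ≠ 0 := by linarith [ht.2]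
  have h2 : 1 + t ≠ 0 := by linarith [ht.1]
  have h3 : t ≠ 0 := ht.1.ne'
  have hd1 := ((hasDerivAt_id t).sub_const 1).mul (((hasDerivAt_id t).const_sub 1).log h1)
  have hd2 := ((hasDerivAt_id t).const_add 1).mul (((hasDerivAt_id t).const_add 1).log h2)
  have hd3 := (Real.hasDerivAt_log h3).const_mul 2
  refine ((hd1.sub hd2).add hd3).congr_deriv ?_
  simp only [id, dlogLam]
  field_simp
  ring

theorem hasDerivAt_dlogLam {t : ℝ} (ht : t ∈ Set.Ioo (0 : ℝ) 1) :
    HasDerivAt dlogLam (-(2 / (1 - t ^ 2)) - 2 / t ^ 2) t := by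
  have h1 : 1 - t ≠ 0 := by linarith [ht.2]
  have h2 : 1 + t ≠ 0 := by linarith [ht.1]
  have h3 : t ≠ 0 := ht.1.ne'
  have h4 : 1 - t ^ 2 ≠ 0 := by
    rw [show 1 - t ^ 2 = (1 - t) * (1 + t) by ring]; exact mul_ne_zero h1 h2
  have hd1 := ((hasDerivAt_id t).const_sub 1).log h1
  have hd2 := ((hasDerivAt_id t).const_add 1).log h2
  have hd3 := (hasDerivAt_inv h3).const_mul 2
  refine ((hd1.sub hd2).add hd3).congr_deriv ?_
  simp only [id]
  rw [show 1 - t ^ 2 = (1 - t) * (1 + t) by ring]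
  field_simp
  ring

/-- The second derivative of log Λ is -2 / (t² (1 - t²)), at most -8 because t² (1 - t²) ≤ 1/4: log
Λ is strongly concave. -/
theorem antitoneOn_dlogLam_add : AntitoneOn (fun t => dlogLam t + 8 * t) (Set.Ioo 0 1) := by
  have hd : ∀ t ∈ Set.Ioo (0 : ℝ) 1, HasDerivAt (fun t => dlogLam t + 8 * t)
      (-(2 / (1 - t ^ 2)) - 2 / t ^ 2 + 8) t := fun t ht =>
    ((hasDerivAt_dlogLam ht).add ((hasDerivAt_id t).const_mul 8)).congr_deriv (by ring)
  refine antitoneOn_of_deriv_nonpos (convex_Ioo 0 1)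
    (fun t ht => (hd t ht).continuousAt.continuousWithinAt)
    (fun t ht => (hd t (interior_subset ht)).differentiableAt.differentiableWithinAt) ?_
  intro t ht
  rw [interior_Ioo] at ht
  rw [(hd t ht).deriv]
  have h1 : 0 < t ^ 2 := pow_pos ht.1 2
  have h2 : 0 < 1 - t ^ 2 := by nlinarith [ht.1, ht.2]
  have h3 : 8 ≤ 2 / (1 - t ^ 2) + 2 / t ^ 2 := by
    rw [div_add_div _ _ h2.ne' h1.ne', le_div_iff₀ (mul_pos h2 h1)]
    nlinarith [sq_nonneg (2 * t ^ 2 - 1)]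
  linarith

/-- Strong concavity puts the graph below a parabola touching it at c. At the critical point this
gives the maximum; at 5/6, close to it, it gives a numerical upper bound. -/
theorem logLam_le {c t : ℝ} (hc : c ∈ Set.Ioo (0 : ℝ) 1) (ht : t ∈ Set.Ioo (0 : ℝ) 1) :
    logLam t ≤ logLam c + dlogLam c * (t - c) - 4 * (t - c) ^ 2 := by
  set φ : ℝ → ℝ := fun t => logLam t - dlogLam c * (t - c) + 4 * (t - c) ^ 2 with hφ
  have hd : ∀ s ∈ Set.Ioo (0 : ℝ) 1,
      HasDerivAt φ ((dlogLam s + 8 * s) - (dlogLam c + 8 * c)) s := by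
    intro s hs
    have h1 := ((hasDerivAt_id s).sub_const c)
    refine (((hasDerivAt_logLam hs).sub (h1.const_mul (dlogLam c))).add
      ((h1.pow 2).const_mul 4)).congr_deriv ?_
    simp only [id]
    ring
  have hkey : φ t ≤ φ c := by
    rcases lt_trichotomy t c with h | h | h
    · have hmem : ∀ s ∈ Set.Icc t c, s ∈ Set.Ioo (0 : ℝ) 1 := fun s hs =>
        ⟨ht.1.trans_le hs.1, hs.2.trans_lt hc.2⟩
      obtain ⟨ξ, hξ, he⟩ := exists_hasDerivAt_eq_slope φ _ h
        (fun s hs => (hd s (hmem s hs)).continuousAt.continuousWithinAt)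
        (fun s hs => hd s (hmem s (Set.Ioo_subset_Icc_self hs)))
      have := antitoneOn_dlogLam_add (hmem ξ (Set.Ioo_subset_Icc_self hξ)) hc hξ.2.le
      simp only at this
      rw [eq_div_iff (by linarith)] at he
      nlinarith
    · rw [h]
    · have hmem : ∀ s ∈ Set.Icc c t, s ∈ Set.Ioo (0 : ℝ) 1 := fun s hs =>
        ⟨hc.1.trans_le hs.1, hs.2.trans_lt ht.2⟩
      obtain ⟨ξ, hξ, he⟩ := exists_hasDerivAt_eq_slope φ _ h
        (fun s hs => (hd s (hmem s hs)).continuousAt.continuousWithinAt)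
        (fun s hs => hd s (hmem s (Set.Ioo_subset_Icc_self hs)))
      have := antitoneOn_dlogLam_add hc (hmem ξ (Set.Ioo_subset_Icc_self hξ)) hξ.1.le
      simp only at this
      rw [eq_div_iff (by linarith)] at he
      nlinarith
  simp only [hφ, sub_self, mul_zero, sub_zero, ne_eq, OfNat.ofNat_ne_zero, not_false_eq_true,
    zero_pow, add_zero] at hkey
  linarith

/-! ### Numerical enclosure of `LamStar` and `kap` -/

theorem log_eleven_lt : Real.log 11 < 2.4 := by
  rw [Real.log_lt_iff_lt_exp (by norm_num)]
  have h : (11 : ℝ) ^ 5 < Real.exp 2.4 ^ 5 := by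
    rw [← Real.exp_nat_mul, show ((5 : ℕ) : ℝ) * 2.4 = (12 : ℕ) * 1 by norm_num,
      Real.exp_nat_mul]
    calc (11 : ℝ) ^ 5 < 2.7182 ^ 12 := by norm_num
      _ ≤ Real.exp 1 ^ 12 := by
        gcongr
        linarith [Real.exp_one_gt_d9]
  exact lt_of_pow_lt_pow_left₀ 5 (Real.exp_pos _).le h

theorem lt_log_eleven : 2.38 < Real.log 11 := by
  rw [Real.lt_log_iff_exp_lt (by norm_num)]
  have h : Real.exp 2.38 ^ 50 < (11 : ℝ) ^ 50 := by
    rw [← Real.exp_nat_mul, show ((50 : ℕ) : ℝ) * 2.38 = (119 : ℕ) * 1 by norm_num,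
      Real.exp_nat_mul]
    calc Real.exp 1 ^ 119 ≤ 2.7183 ^ 119 := by
          gcongr
          linarith [Real.exp_one_lt_d9]
      _ < (11 : ℝ) ^ 50 := by norm_num
  exact lt_of_pow_lt_pow_left₀ 50 (by norm_num) h

theorem five_sixths_mem : (5 / 6 : ℝ) ∈ Set.Ioo (0 : ℝ) 1 := by norm_num

theorem dlogLam_five_sixths : dlogLam (5 / 6) = 2.4 - Real.log 11 := by
  rw [dlogLam, ← Real.log_div (by norm_num) (by norm_num),
    show (1 - 5 / 6 : ℝ) / (1 + 5 / 6) = 11⁻¹ by norm_num, Real.log_inv]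
  norm_num
  ring

theorem logLam_five_sixths : logLam (5 / 6) = 2 * Real.log 5 - 11 / 6 * Real.log 11 := by
  rw [logLam, show (1 - 5 / 6 : ℝ) = 1 / 6 by norm_num, show (1 + 5 / 6 : ℝ) = 11 / 6 by norm_num,
    Real.log_div (by norm_num) (by norm_num), Real.log_div (by norm_num) (by norm_num),
    Real.log_div (by norm_num) (by norm_num), Real.log_one]
  ring

/-- At t = 5/6 the exponents in Λ have denominator 6, so the sixth power is rational and can be
compared exactly. -/
theorem Lam_five_sixths_pow : Lam (5 / 6) ^ 6 = 25 ^ 6 / 11 ^ 11 := by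
  rw [Lam_eq_exp five_sixths_mem, ← Real.exp_nat_mul, logLam_five_sixths,
    show ((6 : ℕ) : ℝ) * (2 * Real.log 5 - 11 / 6 * Real.log 11) =
      (12 : ℕ) * Real.log 5 - (11 : ℕ) * Real.log 11 by push_cast; ring,
    Real.exp_sub, Real.exp_nat_mul, Real.exp_nat_mul, Real.exp_log (by norm_num),
    Real.exp_log (by norm_num)]
  norm_num

theorem exists_dlogLam_eq_zero : ∃ c ∈ Set.Ioo (0 : ℝ) 1, dlogLam c = 0 := by
  have hcont : ContinuousOn dlogLam (Set.Icc (5 / 6) (9 / 10)) := fun t ht =>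
    (hasDerivAt_dlogLam ⟨by linarith [ht.1], by linarith [ht.2]⟩).continuousAt.continuousWithinAt
  have h1 : 0 ≤ dlogLam (5 / 6) := by
    rw [dlogLam_five_sixths]; linarith [log_eleven_lt]
  have h2 : dlogLam (9 / 10) ≤ 0 := by
    rw [dlogLam, ← Real.log_div (by norm_num) (by norm_num),
      show (1 - 9 / 10 : ℝ) / (1 + 9 / 10) = 19⁻¹ by norm_num, Real.log_inv]
    have : Real.log 11 < Real.log 19 := Real.log_lt_log (by norm_num) (by norm_num)
    have := lt_log_eleven
    norm_num at *
    linarith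
  obtain ⟨c, hc, h0⟩ := intermediate_value_Icc' (by norm_num) hcont ⟨h2, h1⟩
  exact ⟨c, ⟨by linarith [hc.1], by linarith [hc.2]⟩, h0⟩

theorem isGreatest_LamStar : IsGreatest (Lam '' Set.Ioo 0 1) LamStar := by
  obtain ⟨c, hc, h0⟩ := exists_dlogLam_eq_zero
  have hg : IsGreatest (Lam '' Set.Ioo 0 1) (Lam c) := by
    refine ⟨⟨c, hc, rfl⟩, ?_⟩
    rintro _ ⟨t, ht, rfl⟩
    rw [Lam_eq_exp ht, Lam_eq_exp hc, Real.exp_le_exp]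
    have := logLam_le hc ht
    rw [h0] at this
    nlinarith [sq_nonneg (t - c)]
  rw [LamStar, hg.csSup_eq]
  exact hg

theorem Lam_le_LamStar {t : ℝ} (ht : t ∈ Set.Ioo (0 : ℝ) 1) : Lam t ≤ LamStar :=
  isGreatest_LamStar.2 ⟨t, ht, rfl⟩

theorem lt_LamStar : 0.30812 < LamStar := by
  refine lt_of_lt_of_le ?_ (Lam_le_LamStar five_sixths_mem)
  refine lt_of_pow_lt_pow_left₀ 6 (Lam_pos five_sixths_mem).le ?_
  rw [Lam_five_sixths_pow]
  norm_num

theorem LamStar_lt : LamStar < 0.30813 := by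
  obtain ⟨t, ht, he⟩ := isGreatest_LamStar.1
  have h1 := logLam_le five_sixths_mem ht
  rw [dlogLam_five_sixths] at h1
  have hlog1 := log_eleven_lt
  have hlog2 := lt_log_eleven
  -- Completing the square, d x - 4 x² ≤ d² / 16 with d = 2.4 - log 11 and |d| ≤ 0.02, and 0.02² /
  -- 16 = 1/40000.
  have h2 : logLam t ≤ logLam (5 / 6) + 1 / 40000 := by
    have : (2.4 - Real.log 11) ^ 2 ≤ 0.02 ^ 2 := by
      apply pow_le_pow_left₀ <;> norm_num at * <;> linarith
    nlinarith [sq_nonneg (8 * (t - 5 / 6) - (2.4 - Real.log 11))]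
  have h3 : LamStar ≤ Lam (5 / 6) * Real.exp (1 / 40000) := by
    rw [← he, Lam_eq_exp ht, Lam_eq_exp five_sixths_mem, ← Real.exp_add, Real.exp_le_exp]
    exact h2
  have h4 : Real.exp (1 / 40000) ≤ 1 / (1 - 1 / 40000) := by
    rw [le_div_iff₀ (by norm_num)]
    have := Real.add_one_le_exp (-(1 / 40000) : ℝ)
    rw [Real.exp_neg] at this
    have hpos := Real.exp_pos (1 / 40000)
    calc Real.exp (1 / 40000) * (1 - 1 / 40000) ≤
        Real.exp (1 / 40000) * (Real.exp (1 / 40000))⁻¹ := by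
          gcongr; linarith
      _ = 1 := mul_inv_cancel₀ hpos.ne'
  have h5 : Lam (5 / 6) < 0.308121 := by
    refine lt_of_pow_lt_pow_left₀ 6 (by norm_num) ?_
    rw [Lam_five_sixths_pow]
    norm_num
  calc LamStar ≤ Lam (5 / 6) * Real.exp (1 / 40000) := h3
    _ ≤ 0.308121 * (1 / (1 - 1 / 40000)) := by
      gcongr
    _ < 0.30813 := by norm_num

theorem LamStar_pos : 0 < LamStar := lt_trans (by norm_num) lt_LamStar

theorem le_kap : 0.27754 ≤ kap := by
  rw [kap]
  apply Real.le_sqrt_of_sq_le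
  have := lt_LamStar
  norm_num at *
  linarith

theorem kap_lt : kap < 0.27755 := by
  rw [kap, Real.sqrt_lt' (by norm_num)]
  have := LamStar_lt
  norm_num at *
  linarith

/-! ### Moments of the coefficients -/

open Stirling in
-- These differences are series whose every term decreases in n; this is log-convexity of the
-- Stirling sequence.
theorem stirlingSeq_sdiff_antitone :
    Antitone fun n : ℕ => Real.log (stirlingSeq (n + 1)) - Real.log (stirlingSeq (n + 2)) := by
  intro a b hab
  refine hasSum_le (fun k => ?_) (log_stirlingSeq_sdiff_hasSum b) (log_stirlingSeq_sdiff_hasSum a)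
  have : (a : ℝ) ≤ b := by exact_mod_cast hab
  push_cast
  gcongr

open Stirling in
theorem two_mul_log_stirlingSeq_le {m j : ℕ} (h : j < m) :
    2 * Real.log (stirlingSeq m) ≤
      Real.log (stirlingSeq (m + j)) + Real.log (stirlingSeq (m - j)) := by
  induction j with
  | zero => simp [two_mul]
  | succ j ih =>
    have h1 := ih (by omega)
    have h2 := stirlingSeq_sdiff_antitone (by omega : m - j - 2 ≤ m + j - 1)
    simp only [show m - j - 2 + 1 = m - (j + 1) by omega, show m - j - 2 + 2 = m - j by omega,
      show m + j - 1 + 1 = m + j by omega, show m + j - 1 + 2 = m + (j + 1) by omega] at h2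
    linarith

open Stirling in
theorem stirlingSeq_pos {n : ℕ} (hn : n ≠ 0) : 0 < stirlingSeq n := by
  obtain ⟨k, rfl⟩ := Nat.exists_eq_succ_of_ne_zero hn
  exact stirlingSeq'_pos k

open Stirling in
theorem stirlingSeq_sq_le {m j : ℕ} (h : j < m) :
    stirlingSeq m ^ 2 ≤ stirlingSeq (m + j) * stirlingSeq (m - j) := by
  have h1 := stirlingSeq_pos (n := m) (by omega)
  have h2 := stirlingSeq_pos (n := m + j) (by omega)
  have h3 := stirlingSeq_pos (n := m - j) (by omega)
  rw [← Real.log_le_log_iff (by positivity) (by positivity), Real.log_pow,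
    Real.log_mul h2.ne' h3.ne']
  exact two_mul_log_stirlingSeq_le h

open Stirling in
theorem factorial_eq_stirlingSeq {n : ℕ} (hn : n ≠ 0) :
    (n.factorial : ℝ) = stirlingSeq n * (√(2 * n : ℝ) * (n / Real.exp 1) ^ n) := by
  have hn' : (0 : ℝ) < n := by exact_mod_cast Nat.pos_of_ne_zero hn
  have h1 : √(2 * n : ℝ) * (n / Real.exp 1) ^ n ≠ 0 := by positivity
  rw [stirlingSeq, div_mul_cancel₀ _ h1]

theorem choose_ratio_eq {m j : ℕ} (h : j ≤ m) :
    ((2 * m).choose (m + j) : ℝ) / ((2 * m).choose m : ℝ) =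
      (m.factorial : ℝ) ^ 2 / ((m + j).factorial * (m - j).factorial) := by
  rw [Nat.cast_choose ℝ (by omega : m + j ≤ 2 * m), Nat.cast_choose ℝ (by omega : m ≤ 2 * m),
    show 2 * m - (m + j) = m - j by omega, show 2 * m - m = m by omega]
  have h1 : ((2 * m).factorial : ℝ) ≠ 0 := by positivity
  have h2 : (m.factorial : ℝ) ≠ 0 := by positivity
  have h3 : ((m + j).factorial : ℝ) ≠ 0 := by positivity
  have h4 : ((m - j).factorial : ℝ) ≠ 0 := by positivity
  field_simp

/-- Writing each factorial as its Stirling approximation times `stirlingSeq`, the correction factors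
have quotient at most 1 by `stirlingSeq_sq_le`. The square roots produce 1 / √(1 - (j/m)²) and the
powers of e cancel. The case j = m is excluded, as the approximation degenerates at 0!. -/
theorem choose_ratio_le {m j : ℕ} (h : j < m) :
    ((2 * m).choose (m + j) : ℝ) / ((2 * m).choose m : ℝ) ≤
      1 / √(1 - ((j : ℝ) / m) ^ 2) *
        ((m : ℝ) ^ (2 * m) / (((m : ℝ) + j) ^ (m + j) * ((m : ℝ) - j) ^ (m - j))) := by
  have hm : (0 : ℝ) < m := by exact_mod_cast (by omega : 0 < m)
  have hj : (j : ℝ) < m := by exact_mod_cast h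
  have hj0 : (0 : ℝ) ≤ j := by positivity
  have hmj : (0 : ℝ) < (m : ℝ) - j := by linarith
  have hpj : (0 : ℝ) < (m : ℝ) + j := by linarith
  have hsq := stirlingSeq_sq_le h
  have hs1 := stirlingSeq_pos (n := m) (by omega)
  have hs2 := stirlingSeq_pos (n := m + j) (by omega)
  have hs3 := stirlingSeq_pos (n := m - j) (by omega)
  have hcast : ((m - j : ℕ) : ℝ) = (m : ℝ) - j := by rw [Nat.cast_sub h.le]
  have hroot : √(2 * (m : ℝ)) ^ 2 = √(2 * ((m : ℝ) + j)) * √(2 * ((m : ℝ) - j)) *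
      (1 / √(1 - ((j : ℝ) / m) ^ 2)) := by
    have h1 : 1 - ((j : ℝ) / m) ^ 2 = (2 * ((m : ℝ) + j)) * (2 * ((m : ℝ) - j)) / (2 * m) ^ 2 := by
      field_simp; ring
    rw [h1, Real.sqrt_div (by positivity), Real.sq_sqrt (by positivity),
      Real.sqrt_mul (by positivity) (2 * ((m : ℝ) - j)), Real.sqrt_sq (by positivity)]
    have h2 : √(2 * ((m : ℝ) + j)) ≠ 0 := by positivity
    have h3 : √(2 * ((m : ℝ) - j)) ≠ 0 := by positivity
    field_simp
  have hexp : ((m : ℝ) / Real.exp 1) ^ m * ((m : ℝ) / Real.exp 1) ^ m =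
      (m : ℝ) ^ (2 * m) / (((m : ℝ) + j) ^ (m + j) * ((m : ℝ) - j) ^ (m - j)) *
      ((((m : ℝ) + j) / Real.exp 1) ^ (m + j) * (((m : ℝ) - j) / Real.exp 1) ^ (m - j)) := by
    have he : Real.exp 1 ^ m * Real.exp 1 ^ m = Real.exp 1 ^ (m + j) * Real.exp 1 ^ (m - j) := by
      rw [← pow_add, ← pow_add]; congr 1; omega
    rw [div_pow, div_pow, div_pow, div_mul_div_comm, div_mul_div_comm, he]
    field_simp
    ring
  rw [choose_ratio_eq h.le, div_le_iff₀ (by positivity), factorial_eq_stirlingSeq (n := m)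
    (by omega), factorial_eq_stirlingSeq (n := m + j) (by omega),
    factorial_eq_stirlingSeq (n := m - j) (by omega), hcast]
  push_cast
  set A := (m : ℝ) ^ (2 * m) / (((m : ℝ) + j) ^ (m + j) * ((m : ℝ) - j) ^ (m - j))
  set B := (((m : ℝ) + j) / Real.exp 1) ^ (m + j)
  set C := (((m : ℝ) - j) / Real.exp 1) ^ (m - j)
  set D := 1 / √(1 - ((j : ℝ) / m) ^ 2)
  calc (Stirling.stirlingSeq m * (√(2 * (m : ℝ)) * ((m : ℝ) / Real.exp 1) ^ m)) ^ 2 =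
      Stirling.stirlingSeq m ^ 2 * (√(2 * (m : ℝ)) ^ 2 *
        (((m : ℝ) / Real.exp 1) ^ m * ((m : ℝ) / Real.exp 1) ^ m)) := by ring
    _ ≤ (Stirling.stirlingSeq (m + j) * Stirling.stirlingSeq (m - j)) * (√(2 * (m : ℝ)) ^ 2 *
        (((m : ℝ) / Real.exp 1) ^ m * ((m : ℝ) / Real.exp 1) ^ m)) := by gcongr
    _ = _ := by
      rw [hroot, hexp]; ring

theorem Lam_pow {m j : ℕ} (hj : 0 < j) (h : j < m) :
    Lam ((j : ℝ) / m) ^ m = (m : ℝ) ^ (2 * m) / (((m : ℝ) + j) ^ (m + j) *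
      ((m : ℝ) - j) ^ (m - j)) * ((j : ℝ) / m) ^ (2 * m) := by
  have hm : (0 : ℝ) < m := by exact_mod_cast (by omega : 0 < m)
  have hj' : (j : ℝ) < m := by exact_mod_cast h
  have hj0 : (0 : ℝ) < j := by exact_mod_cast hj
  have hmj : (0 : ℝ) < (m : ℝ) - j := by linarith
  have h1 : (1 : ℝ) - (j : ℝ) / m = ((m : ℝ) - j) / m := by field_simp
  have h2 : (1 : ℝ) + (j : ℝ) / m = ((m : ℝ) + j) / m := by field_simp
  have hcast : ((m - j : ℕ) : ℝ) = (m : ℝ) - j := by rw [Nat.cast_sub h.le]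
  have e1 : ((1 - (j : ℝ) / m) ^ ((j : ℝ) / m - 1)) ^ m =
      ((((m : ℝ) - j) / m) ^ (m - j))⁻¹ := by
    rw [← Real.rpow_natCast (_ ^ _) m, ← Real.rpow_mul (by rw [h1]; positivity), h1,
      ← Real.rpow_natCast _ (m - j), ← Real.rpow_neg (by positivity), hcast]
    congr 1
    field_simp
    ring
  have e2 : ((1 + (j : ℝ) / m) ^ (-1 - (j : ℝ) / m)) ^ m =
      ((((m : ℝ) + j) / m) ^ (m + j))⁻¹ := by
    rw [← Real.rpow_natCast (_ ^ _) m, ← Real.rpow_mul (by positivity), h2,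
      ← Real.rpow_natCast _ (m + j), ← Real.rpow_neg (by positivity)]
    congr 1
    push_cast
    field_simp
    ring
  have hpow : (m : ℝ) ^ (2 * m) = (m : ℝ) ^ (m - j) * (m : ℝ) ^ (m + j) := by
    rw [← pow_add]; congr 1; omega
  rw [Lam, mul_pow, mul_pow, e1, e2, ← pow_mul, hpow]
  congr 1
  rw [div_pow, div_pow, inv_div, inv_div, div_mul_div_comm]
  congr 1
  ring

theorem choose_ratio_mul_pow_le {m j : ℕ} (hj : 0 < j) (h : j < m) :
    ((2 * m).choose (m + j) : ℝ) / ((2 * m).choose m : ℝ) * ((j : ℝ) / m) ^ (2 * m) ≤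
      LamStar ^ m * (1 / √(1 - ((j : ℝ) / m) ^ 2)) := by
  have hm : (0 : ℝ) < m := by exact_mod_cast (by omega : 0 < m)
  have hj0 : (0 : ℝ) < j := by exact_mod_cast hj
  have ht : (j : ℝ) / m ∈ Set.Ioo (0 : ℝ) 1 :=
    ⟨by positivity, by rw [div_lt_one hm]; exact_mod_cast h⟩
  calc _ ≤ 1 / √(1 - ((j : ℝ) / m) ^ 2) *
        ((m : ℝ) ^ (2 * m) / (((m : ℝ) + j) ^ (m + j) * ((m : ℝ) - j) ^ (m - j))) *
          ((j : ℝ) / m) ^ (2 * m) := by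
        gcongr
        exact choose_ratio_le h
    _ = 1 / √(1 - ((j : ℝ) / m) ^ 2) * Lam ((j : ℝ) / m) ^ m := by
        rw [Lam_pow hj h, mul_assoc]
    _ ≤ 1 / √(1 - ((j : ℝ) / m) ^ 2) * LamStar ^ m := by
        gcongr
        · exact (Lam_pos ht).le
        · exact Lam_le_LamStar ht
    _ = _ := mul_comm _ _

/-- Convexity of arcsin on [0, 1], seen through sine: sin y ≤ sin x + (y - x) cos x for x ≤ y with
sin x and cos x nonnegative. -/
theorem div_sqrt_le_arcsin_sub {a b : ℝ} (ha : 0 ≤ a) (hab : a ≤ b) (hb : b ≤ 1) (ha1 : a < 1) :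
    (b - a) * (1 / √(1 - a ^ 2)) ≤ Real.arcsin b - Real.arcsin a := by
  set x := Real.arcsin a with hx
  set y := Real.arcsin b with hy
  have hsx : Real.sin x = a := Real.sin_arcsin (by linarith) (by linarith)
  have hsy : Real.sin y = b := Real.sin_arcsin (by linarith) hb
  have hcx : Real.cos x = √(1 - a ^ 2) := Real.cos_arcsin a
  have hxy : x ≤ y := Real.monotone_arcsin hab
  have hpos : 0 < √(1 - a ^ 2) := Real.sqrt_pos.2 (by nlinarith)
  rw [mul_one_div, div_le_iff₀ hpos]
  have h1 : Real.sin y = Real.sin x * Real.cos (y - x) + Real.cos x * Real.sin (y - x) := by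
    rw [← Real.sin_add]; congr 1; ring
  have h2 : Real.sin (y - x) ≤ y - x := Real.sin_le (by linarith)
  have h3 : Real.cos (y - x) ≤ 1 := Real.cos_le_one _
  rw [hsy, hsx, hcx] at h1
  nlinarith

theorem sum_inv_sqrt_le {m : ℕ} (hm : 0 < m) :
    ∑ j ∈ Finset.range m, 1 / √(1 - ((j : ℝ) / m) ^ 2) ≤ m * (Real.pi / 2) := by
  have hm' : (0 : ℝ) < m := by exact_mod_cast hm
  have hterm : ∀ j ∈ Finset.range m, 1 / √(1 - ((j : ℝ) / m) ^ 2) ≤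
      m * (Real.arcsin (((j + 1 : ℕ) : ℝ) / m) - Real.arcsin ((j : ℝ) / m)) := by
    intro j hj
    rw [Finset.mem_range] at hj
    have hj1 : ((j + 1 : ℕ) : ℝ) ≤ m := by exact_mod_cast hj
    have hj2 : (j : ℝ) < m := by exact_mod_cast hj
    have := div_sqrt_le_arcsin_sub (a := (j : ℝ) / m) (b := ((j + 1 : ℕ) : ℝ) / m) (by positivity)
      (by gcongr; omega) (by rwa [div_le_one hm']) (by rwa [div_lt_one hm'])
    have he : ((j + 1 : ℕ) : ℝ) / m - (j : ℝ) / m = 1 / m := by push_cast; ring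
    rw [he] at this
    calc 1 / √(1 - ((j : ℝ) / m) ^ 2) = m * (1 / m * (1 / √(1 - ((j : ℝ) / m) ^ 2))) := by
          rw [← mul_assoc, mul_one_div_cancel hm'.ne', one_mul]
      _ ≤ _ := by gcongr
  refine (Finset.sum_le_sum hterm).trans_eq ?_
  rw [← Finset.mul_sum, Finset.sum_range_sub (fun j : ℕ => Real.arcsin ((j : ℝ) / m))]
  simp [hm'.ne']

theorem one_le_centralBinom_mul {m : ℕ} (hm : 8 ≤ m) :
    1 ≤ ((2 * m).choose m : ℝ) * LamStar ^ m := by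
  have hL := lt_LamStar
  suffices h : 1 ≤ ((2 * m).choose m : ℝ) * (0.308 : ℝ) ^ m by
    refine h.trans ?_
    gcongr
    linarith
  induction m, hm using Nat.le_induction with
  -- The start 8 is sharp here: the product is still below 1 for m = 7. From 8 on, consecutive
  -- products grow by the factor 0.308 · 2(2m+1)/(m+1) > 1.
  | base => norm_num [Nat.choose]
  | succ m hm ih =>
    have h1 := Nat.succ_mul_centralBinom_succ m
    simp only [Nat.centralBinom] at h1
    have h2 : ((m : ℝ) + 1) * ((2 * (m + 1)).choose (m + 1) : ℝ) =
        2 * (2 * m + 1) * ((2 * m).choose m : ℝ) := by exact_mod_cast h1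
    have hm' : (8 : ℝ) ≤ m := by exact_mod_cast hm
    have h3 : (0 : ℝ) ≤ ((2 * m).choose m : ℝ) * (0.308 : ℝ) ^ m := by positivity
    have h4 : ((m : ℝ) + 1) * (((2 * (m + 1)).choose (m + 1) : ℝ) * (0.308 : ℝ) ^ (m + 1)) =
        0.308 * (2 * (2 * m + 1)) * (((2 * m).choose m : ℝ) * (0.308 : ℝ) ^ m) := by
      rw [← mul_assoc, h2]; ring
    have h5 : ((m : ℝ) + 1) * 1 ≤
        ((m : ℝ) + 1) * (((2 * (m + 1)).choose (m + 1) : ℝ) * (0.308 : ℝ) ^ (m + 1)) := by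
      rw [h4]
      nlinarith
    exact le_of_mul_le_mul_left h5 (by positivity)

/-- The `2m`-th moment, scaled by `m`, of the weights `j |γ_{m,j}|`. -/
noncomputable def scaledMoment (m : ℕ) : ℝ :=
  ∑ j ∈ Finset.Icc 1 m, 2 * ((2 * m).choose (m + j) : ℝ) / ((2 * m).choose m : ℝ) *
    ((j : ℝ) / m) ^ (2 * m)

theorem scaledMoment_le_of_eight_le {m : ℕ} (hm : 8 ≤ m) :
    scaledMoment m ≤ Real.pi * m * LamStar ^ m := by
  have hL := LamStar_pos
  have hm0 : (0 : ℝ) < m := by exact_mod_cast (by omega : 0 < m)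
  have hchoose : (0 : ℝ) < ((2 * m).choose m : ℝ) := by
    exact_mod_cast Nat.choose_pos (by omega)
  obtain ⟨q, rfl⟩ : ∃ q, m = q + 1 := ⟨m - 1, by omega⟩
  have hsum := sum_inv_sqrt_le (m := q + 1) (by omega)
  -- The j = 0 term of the Riemann sum, equal to 1, is unused by the moment; it pays for the term j
  -- = m, where the estimate by 1 / √(1 - t²) is unavailable.
  rw [Finset.sum_range_succ'] at hsum
  rw [scaledMoment, ← Finset.Ico_add_one_right_eq_Icc, Finset.sum_Ico_eq_sum_range,
    Nat.add_sub_cancel, Finset.sum_range_succ]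
  have hlast : 2 * ((2 * (q + 1)).choose (q + 1 + (1 + q)) : ℝ) /
      ((2 * (q + 1)).choose (q + 1) : ℝ) * (((1 + q : ℕ) : ℝ) / ((q + 1 : ℕ) : ℝ)) ^ (2 * (q + 1)) ≤
      2 * LamStar ^ (q + 1) := by
    rw [show q + 1 + (1 + q) = 2 * (q + 1) by ring, Nat.choose_self, add_comm 1 q,
      div_self hm0.ne', one_pow, mul_one, Nat.cast_one, div_le_iff₀ hchoose]
    have := one_le_centralBinom_mul hm
    nlinarith
  have hrest : ∀ j ∈ Finset.range q, 2 * ((2 * (q + 1)).choose (q + 1 + (1 + j)) : ℝ) /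
      ((2 * (q + 1)).choose (q + 1) : ℝ) * (((1 + j : ℕ) : ℝ) / ((q + 1 : ℕ) : ℝ)) ^ (2 * (q + 1)) ≤
      2 * LamStar ^ (q + 1) * (1 / √(1 - (((j + 1 : ℕ) : ℝ) / ((q + 1 : ℕ) : ℝ)) ^ 2)) := by
    intro j hj
    rw [Finset.mem_range] at hj
    have := choose_ratio_mul_pow_le (m := q + 1) (j := j + 1) (by omega) (by omega)
    rw [add_comm 1 j, mul_div_assoc, mul_assoc, mul_assoc]
    exact mul_le_mul_of_nonneg_left this (by norm_num)
  have h0 : 1 / √(1 - (((0 : ℕ) : ℝ) / ((q + 1 : ℕ) : ℝ)) ^ 2) = 1 := by simp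
  rw [h0] at hsum
  have hadd := add_le_add (Finset.sum_le_sum hrest) hlast
  refine hadd.trans ?_
  rw [← Finset.mul_sum]
  have hpow : 0 < LamStar ^ (q + 1) := by positivity
  nlinarith

theorem scaledMoment_le_of_two_le {m : ℕ} (hm : 2 ≤ m) :
    scaledMoment m ≤ Real.pi * m * LamStar ^ m := by
  rcases le_or_gt 8 m with h | h
  · exact scaledMoment_le_of_eight_le h
  have hpi := Real.pi_gt_three
  have hL := lt_LamStar
  suffices hs : scaledMoment m ≤ 3 * m * (0.308 : ℝ) ^ m by
    refine hs.trans ?_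
    gcongr
    linarith
  -- For 2 ≤ m ≤ 7 the inequality holds even with π replaced by 3 and Λ_* by 0.308.
  interval_cases m <;>
    norm_num [scaledMoment, Finset.sum_Icc_succ_top, Nat.choose]

theorem scaledMoment_one_le : scaledMoment 1 ≤ 1.0331 * (Real.pi * (1 : ℕ) * LamStar ^ 1) := by
  have hpi := Real.pi_gt_d6
  have hL := lt_LamStar
  have h1 : scaledMoment 1 = 1 := by norm_num [scaledMoment, Nat.choose]
  rw [h1, pow_one]
  push_cast
  norm_num at *
  nlinarith

/-! ### The closed-form bound -/

theorem centralBinom_ratio_le {m : ℕ} (hm : 1 ≤ m) :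
    4 ^ m / ((2 * m).choose m : ℝ) ≤ √(Real.pi * m) + 1 := by
  have hW := Real.Wallis.W_le m
  have hm' : (1 : ℝ) ≤ m := by exact_mod_cast hm
  have hpi := Real.pi_gt_three
  have hpi4 := Real.pi_lt_four
  have hsq : (4 ^ m / ((2 * m).choose m : ℝ)) ^ 2 ≤ Real.pi * m + Real.pi / 2 := by
    rw [Real.Wallis.W_eq_factorial_ratio, div_le_iff₀ (by positivity)] at hW
    rw [Nat.cast_choose ℝ (by omega : m ≤ 2 * m), show 2 * m - m = m by omega]
    have h1 : (m.factorial : ℝ) ≠ 0 := by positivity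
    have h2 : ((2 * m).factorial : ℝ) ≠ 0 := by positivity
    have h4 : ((4 : ℝ) ^ m) ^ 2 = 2 ^ (4 * m) := by
      rw [← pow_mul, show (4 : ℝ) = 2 ^ 2 by norm_num, ← pow_mul]; congr 1; ring
    rw [div_pow, h4, div_le_iff₀ (by positivity), div_pow, ← mul_div_assoc,
      le_div_iff₀ (by positivity)]
    calc _ = 2 ^ (4 * m) * (m.factorial : ℝ) ^ 4 := by ring
      _ ≤ _ := hW
      _ = _ := by ring
  have hs : 1 ≤ √(Real.pi * m) := by
    rw [Real.one_le_sqrt]; nlinarith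
  refine le_of_sq_le_sq (hsq.trans ?_) (by positivity)
  have := Real.sq_sqrt (show 0 ≤ Real.pi * m by positivity)
  -- Squaring √(π m) + 1 gives at least π m + 3, which exceeds π m + π/2.
  nlinarith

theorem sum_choose_add {m : ℕ} :
    (∑ j ∈ Finset.Icc 1 m, 2 * ((2 * m).choose (m + j) : ℝ)) + ((2 * m).choose m : ℝ) = 4 ^ m := by
  have h := Nat.sum_range_choose (2 * m)
  rw [show 2 * m + 1 = (m + 1) + m by omega, Finset.sum_range_add, Finset.sum_range_succ,
    ← Finset.sum_range_reflect (n := m)] at h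
  have hlow : ∀ j ∈ Finset.range m, (2 * m).choose (m - 1 - j) = (2 * m).choose (m + 1 + j) := by
    intro j hj
    rw [Finset.mem_range] at hj
    rw [← Nat.choose_symm (by omega : m - 1 - j ≤ 2 * m)]
    congr 1; omega
  rw [Finset.sum_congr rfl hlow, pow_mul] at h
  rw [← Finset.Ico_add_one_right_eq_Icc, Finset.sum_Ico_eq_sum_range, Nat.add_sub_cancel,
    ← Finset.mul_sum]
  have h' := congrArg (Nat.cast : ℕ → ℝ) h
  push_cast at h'
  simp only [← add_assoc]
  linarith

theorem abs_gam_mul_self {m j : ℕ} (hj : 1 ≤ j) :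
    |gam m j| * (j : ℝ) = 2 * ((2 * m).choose (m + j) : ℝ) / ((2 * m).choose m : ℝ) := by
  have hj' : (j : ℝ) ≠ 0 := by positivity
  rw [gam, abs_div, abs_mul, abs_mul, abs_pow, abs_neg, abs_one, one_pow, one_mul,
    abs_of_nonneg (by positivity), Nat.abs_cast, Nat.abs_cast]
  field_simp

theorem sum_abs_gam_le {m : ℕ} (hm : 1 ≤ m) :
    ∑ j ∈ Finset.Icc 1 m, |gam m j| * (j : ℝ) ≤ √(Real.pi * m) := by
  have hchoose : (0 : ℝ) < ((2 * m).choose m : ℝ) := by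
    exact_mod_cast Nat.choose_pos (by omega)
  rw [Finset.sum_congr rfl fun j hj => abs_gam_mul_self (Finset.mem_Icc.1 hj).1,
    ← Finset.sum_div, eq_sub_of_add_eq (sum_choose_add (m := m)), sub_div, div_self hchoose.ne']
  linarith [centralBinom_ratio_le hm]

theorem sum_abs_gam_mul_pow {m : ℕ} (hm : 1 ≤ m) :
    ∑ j ∈ Finset.Icc 1 m, |gam m j| * (j : ℝ) * (j : ℝ) ^ (2 * m) =
      (m : ℝ) ^ (2 * m) * scaledMoment m := by
  have hm' : (m : ℝ) ≠ 0 := by positivity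
  rw [scaledMoment, Finset.mul_sum]
  refine Finset.sum_congr rfl fun j hj => ?_
  rw [abs_gam_mul_self (Finset.mem_Icc.1 hj).1, div_pow]
  field_simp

/-! ### From one-variable moments to the multi-index bound -/

theorem one_add_sum_le_prod {ι : Type*} (s : Finset ι) (α : ι → ℕ) :
    1 + ∑ r ∈ s, α r ≤ ∏ r ∈ s, (α r + 1) := by
  classical
  induction s using Finset.induction_on with
  | empty => simp
  | insert a s ha ih =>
    rw [Finset.sum_insert ha, Finset.prod_insert ha]
    nlinarith [Nat.zero_le (∑ r ∈ s, α r), Nat.zero_le (α a),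
      Nat.zero_le (α a * ∑ r ∈ s, α r)]

/-- Since ∏ (α_r + 1) ≥ d + 1, each coefficient is at most the multinomial coefficient divided by
(d+1)!, and the multinomial theorem sums these. -/
theorem sum_ofDegree_monomial_le {p d : ℕ} {y : Fin p → ℝ} (hy : ∀ r, 0 ≤ y r) :
    ∑ α ∈ ofDegree p d, 1 / (∏ r, ((α r + 1).factorial : ℝ)) * ∏ r, y r ^ α r ≤
      (∑ r, y r) ^ d / ((d + 1).factorial : ℝ) := by
  rw [Finset.sum_pow_eq_sum_piAntidiag, Finset.sum_div]
  refine Finset.sum_le_sum fun α hα => ?_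
  have hdeg : ∑ r, α r = d := mem_ofDegree.1 hα
  have hmult : (∏ r, ((α r).factorial : ℝ)) * (Nat.multinomial Finset.univ α : ℝ) =
      (d.factorial : ℝ) := by
    have := Nat.multinomial_spec Finset.univ α
    rw [hdeg] at this
    exact_mod_cast this
  have hprod : (d + 1 : ℝ) ≤ ∏ r, ((α r : ℝ) + 1) := by
    have := one_add_sum_le_prod Finset.univ α
    rw [hdeg, add_comm] at this
    exact_mod_cast this
  have hfac : (∏ r, ((α r + 1).factorial : ℝ)) =
      (∏ r, ((α r : ℝ) + 1)) * ∏ r, ((α r).factorial : ℝ) := by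
    rw [← Finset.prod_mul_distrib]
    exact Finset.prod_congr rfl fun r _ => by rw [Nat.factorial_succ]; push_cast; rfl
  have hpos : 0 < ∏ r, ((α r).factorial : ℝ) := Finset.prod_pos fun r _ => by positivity
  have hmon : 0 ≤ ∏ r, y r ^ α r := Finset.prod_nonneg fun r _ => pow_nonneg (hy r) _
  rw [mul_div_right_comm]
  refine mul_le_mul_of_nonneg_right ?_ hmon
  rw [hfac, Nat.factorial_succ, Nat.cast_mul, ← hmult, Nat.cast_add, Nat.cast_one]
  calc 1 / ((∏ r, ((α r : ℝ) + 1)) * ∏ r, ((α r).factorial : ℝ)) ≤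
      1 / ((d + 1 : ℝ) * ∏ r, ((α r).factorial : ℝ)) := by gcongr
    _ = _ := by
      have hne : (Nat.multinomial Finset.univ α : ℝ) ≠ 0 := by
        intro h
        rw [h, mul_zero] at hmult
        exact (Nat.cast_ne_zero.2 (Nat.factorial_ne_zero d)) hmult.symm
      field_simp

/-- The power mean inequality replaces the power of the sum by p^(2m-1) times the sum of powers.
Each resulting term involves one distinguished coordinate, so the sum over j factors, and the p
equal contributions supply the last factor p. -/
theorem sum_prod_mul_sum_pow_le {p m : ℕ} (hm : 1 ≤ m) {c : ℕ → ℝ}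
    (hc : ∀ j, 0 ≤ c j) :
    ∑ j ∈ upTo p m, (∏ r, c (j r)) * (∑ r, (j r : ℝ)) ^ (2 * m) ≤
      (p : ℝ) ^ (2 * m) * ((∑ j ∈ Finset.Icc 1 m, c j) ^ (p - 1) *
        ∑ j ∈ Finset.Icc 1 m, c j * (j : ℝ) ^ (2 * m)) := by
  obtain ⟨N, hN⟩ : ∃ N, 2 * m = N + 1 := ⟨2 * m - 1, by omega⟩
  have hpow : ∀ j : Fin p → ℕ, (∑ r, (j r : ℝ)) ^ (2 * m) ≤
      (p : ℝ) ^ N * ∑ r, (j r : ℝ) ^ (2 * m) := by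
    intro j
    rw [hN]
    simpa using pow_sum_le_card_mul_sum_pow (s := Finset.univ) (f := fun r => (j r : ℝ))
      (fun r _ => by positivity) N
  have hcoord : ∀ r : Fin p, ∑ j ∈ upTo p m, (∏ s, c (j s)) * (j r : ℝ) ^ (2 * m) =
      (∑ j ∈ Finset.Icc 1 m, c j) ^ (p - 1) * ∑ j ∈ Finset.Icc 1 m, c j * (j : ℝ) ^ (2 * m) := by
    intro r
    have h1 : ∀ j : Fin p → ℕ, (∏ s, c (j s)) * (j r : ℝ) ^ (2 * m) =
        ∏ s, c (j s) * (if s = r then (j s : ℝ) ^ (2 * m) else 1) := by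
      intro j
      rw [Finset.prod_mul_distrib, Finset.prod_ite_eq' Finset.univ r]
      simp
    simp only [h1]
    rw [upTo_eq, ← Finset.prod_univ_sum (fun _ : Fin p => Finset.Icc 1 m)
      (fun s j => c j * (if s = r then (j : ℝ) ^ (2 * m) else 1)),
      ← Finset.prod_erase_mul _ _ (Finset.mem_univ r)]
    congr 1
    · rw [Finset.prod_congr rfl (g := fun _ => ∑ j ∈ Finset.Icc 1 m, c j)]
      · simp
      · intro s hs
        simp [Finset.ne_of_mem_erase hs]
    · simp
  calc _ ≤ ∑ j ∈ upTo p m, (∏ r, c (j r)) * ((p : ℝ) ^ N * ∑ r, (j r : ℝ) ^ (2 * m)) :=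
        Finset.sum_le_sum fun j _ => mul_le_mul_of_nonneg_left (hpow j)
          (Finset.prod_nonneg fun r _ => hc _)
    _ = (p : ℝ) ^ N * ∑ r, ∑ j ∈ upTo p m, (∏ s, c (j s)) * (j r : ℝ) ^ (2 * m) := by
        rw [Finset.sum_comm, Finset.mul_sum]
        refine Finset.sum_congr rfl fun j _ => ?_
        rw [Finset.mul_sum, Finset.mul_sum, Finset.mul_sum]
        exact Finset.sum_congr rfl fun r _ => by ring
    _ = _ := by
        simp only [hcoord]
        rw [Finset.sum_const, Finset.card_univ, Fintype.card_fin, nsmul_eq_mul, ← mul_assoc,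
          ← pow_succ, hN]

theorem sum_remainder_weights_le {p m : ℕ} (hm : 1 ≤ m) :
    ∑ α ∈ ofDegree p (2 * m), 1 / (∏ r, ((α r + 1).factorial : ℝ)) *
      ∑ j ∈ upTo p m, |gamVec m j| * ∏ r, (j r : ℝ) ^ (α r + 1) ≤
    (p : ℝ) ^ (2 * m) * (√(Real.pi * m) ^ (p - 1) * ((m : ℝ) ^ (2 * m) * scaledMoment m)) /
      ((2 * m + 1).factorial : ℝ) := by
  set c : ℕ → ℝ := fun j => |gam m j| * j with hc
  have hc0 : ∀ j, 0 ≤ c j := fun j => by positivity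
  have hterm : ∀ (j α : Fin p → ℕ), |gamVec m j| * ∏ r, (j r : ℝ) ^ (α r + 1) =
      (∏ r, c (j r)) * ∏ r, (j r : ℝ) ^ α r := by
    intro j α
    rw [gamVec, Finset.abs_prod, ← Finset.prod_mul_distrib, ← Finset.prod_mul_distrib]
    exact Finset.prod_congr rfl fun r _ => by simp only [hc]; ring
  have hsm : 0 ≤ (m : ℝ) ^ (2 * m) * scaledMoment m := by
    rw [← sum_abs_gam_mul_pow hm]
    exact Finset.sum_nonneg fun j _ => by positivity
  simp only [hterm]
  calc _ = ∑ j ∈ upTo p m, (∏ r, c (j r)) * ∑ α ∈ ofDegree p (2 * m),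
        1 / (∏ r, ((α r + 1).factorial : ℝ)) * ∏ r, (j r : ℝ) ^ α r := by
        simp only [Finset.mul_sum]
        rw [Finset.sum_comm]
        exact Finset.sum_congr rfl fun j _ => Finset.sum_congr rfl fun α _ => by ring
    _ ≤ ∑ j ∈ upTo p m, (∏ r, c (j r)) * ((∑ r, (j r : ℝ)) ^ (2 * m) /
          ((2 * m + 1).factorial : ℝ)) :=
        Finset.sum_le_sum fun j _ => mul_le_mul_of_nonneg_left
          (sum_ofDegree_monomial_le fun r => by positivity)
          (Finset.prod_nonneg fun r _ => hc0 _)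
    _ = (∑ j ∈ upTo p m, (∏ r, c (j r)) * (∑ r, (j r : ℝ)) ^ (2 * m)) /
          ((2 * m + 1).factorial : ℝ) := by
        rw [Finset.sum_div]
        exact Finset.sum_congr rfl fun j _ => by ring
    _ ≤ _ := by
        gcongr
        refine (sum_prod_mul_sum_pow_le hm hc0).trans ?_
        rw [sum_abs_gam_mul_pow hm]
        gcongr
        exact sum_abs_gam_le hm

theorem remainderBound_le_closedBound {p m : ℕ} (hp : 1 ≤ p) (hm : 1 ≤ m) {C M : ℝ} (hM : 0 ≤ M)
    (hC : scaledMoment m ≤ C * (Real.pi * m * LamStar ^ m)) :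
    remainderBound p m M ≤ closedBound p m C M := by
  have hpi := Real.pi_pos
  have hm0 : (0 : ℝ) < m := by exact_mod_cast hm
  have hL := LamStar_pos
  have hkap : kap ^ (2 * m) = LamStar ^ m / 2 ^ (2 * m) := by
    rw [pow_mul, kap, Real.sq_sqrt (by positivity), div_pow, pow_mul]
    norm_num
  have hroot : (Real.pi * m) ^ (((p : ℝ) + 1) / 2) = √(Real.pi * m) ^ (p - 1) * (Real.pi * m) := by
    have hp' : ((p - 1 : ℕ) : ℝ) = (p : ℝ) - 1 := by rw [Nat.cast_sub hp]; simp
    rw [Real.sqrt_eq_rpow, ← Real.rpow_natCast, ← Real.rpow_mul (by positivity), hp']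
    nth_rewrite 3 [← Real.rpow_one (Real.pi * m)]
    rw [← Real.rpow_add (by positivity)]
    congr 1
    ring
  rw [remainderBound, closedBound, hroot, mul_pow, mul_pow, hkap]
  calc _ ≤ M / 2 ^ (2 * m) * ((p : ℝ) ^ (2 * m) * (√(Real.pi * m) ^ (p - 1) *
        ((m : ℝ) ^ (2 * m) * scaledMoment m)) / ((2 * m + 1).factorial : ℝ)) :=
        mul_le_mul_of_nonneg_left (sum_remainder_weights_le hm) (by positivity)
    _ ≤ M / 2 ^ (2 * m) * ((p : ℝ) ^ (2 * m) * (√(Real.pi * m) ^ (p - 1) *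
        ((m : ℝ) ^ (2 * m) * (C * (Real.pi * m * LamStar ^ m)))) /
          ((2 * m + 1).factorial : ℝ)) := by gcongr
    _ = _ := by ring

theorem remainderBound_le_closedBound_of_two_le {p m : ℕ} (hp : 1 ≤ p) (hm : 2 ≤ m) {C M : ℝ}
    (hC : 1 ≤ C) (hM : 0 ≤ M) : remainderBound p m M ≤ closedBound p m C M := by
  have hL := LamStar_pos
  refine remainderBound_le_closedBound hp (by omega) hM ((scaledMoment_le_of_two_le hm).trans ?_)
  exact le_mul_of_one_le_left (by positivity) hC

end AltSum

open AltSum in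
theorem theorem2p1 (p m : ℕ) (hp : 1 ≤ p) (hm : 1 ≤ m) (n : Fin p → ℕ)
    (f : (Fin p → ℝ) → ℝ) (hf : ContDiff ℝ ((2 * m : ℕ) : WithTop ℕ∞) f) :
    -- the summation formula
    (∑ k ∈ below n, f (fun r => (k r : ℝ)) = approx m n f - remainder m n f) ∧
    -- the five other forms of the approximation
    (approx m n f = ∑ j ∈ upTo p m, gamVec m j * ∑ i ∈ below j,
      boxInt (fun r => -1 + (j r : ℝ) / 2 - (i r : ℝ))
        (fun r => (n r : ℝ) - 1 + (j r : ℝ) / 2 - (i r : ℝ)) f) ∧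
    (approx m n f = ∑ β ∈ symBox p m, tauVec m (1 + absVec β) *
      boxInt (fun r => (β r : ℝ) / 2 - 1 / 2) (fun r => (n r : ℝ) - 1 / 2 - (β r : ℝ) / 2) f) ∧
    (approx m n f = ∑ β ∈ symBox p m, tauVec m (1 + absVec β) *
      boxInt (fun r => -1 / 2 - (β r : ℝ) / 2) (fun r => (n r : ℝ) - 1 / 2 - (β r : ℝ) / 2) f) ∧
    (approx m n f = ∑ α ∈ below (fun _ : Fin p => m), tauVec m (1 + α) * ∑ β ∈ signed α,
      boxInt (fun r => (β r : ℝ) / 2 - 1 / 2) (fun r => (n r : ℝ) - 1 / 2 - (β r : ℝ) / 2) f) ∧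
    (approx m n f = ∑ α ∈ below (fun _ : Fin p => m), tauVec m (1 + α) * ∑ β ∈ signed α,
      boxInt (fun r => -1 / 2 - (β r : ℝ) / 2) (fun r => (n r : ℝ) - 1 / 2 - (β r : ℝ) / 2) f) ∧
    -- the series form of the coefficients `τ`
    (∀ j : ℕ, 1 ≤ j → j ≤ m → HasSum (fun β : ℕ => gam m (j + 2 * β)) (tau m j)) ∧
    -- the coefficients in each form sum to one
    (∑ j ∈ upTo p m, gamVec m j * ∑ _i ∈ below j, (1 : ℝ) = 1) ∧
    (∑ j ∈ upTo p m, gamVec m j * ∏ r, (j r : ℝ) = 1) ∧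
    (∑ β ∈ symBox p m, tauVec m (1 + absVec β) = 1) ∧
    (∑ α ∈ below (fun _ : Fin p => m), tauVec m (1 + α) * ∑ _β ∈ signed α, (1 : ℝ) = 1) ∧
    -- the bounds on the remainder
    (∀ M : ℝ,
      (∀ α : Fin p → ℕ, ∑ r, α r = 2 * m →
        ∀ u : Fin p → ℝ, (∀ r, -(m : ℝ) / 2 < u r ∧ u r ≤ (m : ℝ) / 2) →
          |∑ k ∈ below n, multiDeriv α f (fun r => (k r : ℝ) + u r)| ≤ M) →
      |remainder m n f| ≤ remainderBound p m M ∧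
      remainderBound p m M ≤ closedBound p m 1.0331 M ∧
      (2 ≤ m → remainderBound p m M ≤ closedBound p m 1.001 M)) ∧
    -- the constants
    IsGreatest (Lam '' Set.Ioo 0 1) LamStar ∧
    (0.3081 ≤ LamStar ∧ LamStar < 0.3082) ∧
    (0.27754 ≤ kap ∧ kap < 0.27755) := by
  have hc : Continuous f := hf.continuous
  refine ⟨sum_eq_approx_sub_remainder hp hm n hf, approx_eq_sum_shifted m n hc,
    approx_eq_sum_tau m n hc, approx_eq_sum_tau_shifted m n hc, ?_, ?_,
    fun j _ _ => hasSum_tau m j, sum_gamVec_mul_sum_one hm, sum_gamVec_mul_prod_self hm,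
    sum_tauVec hm, ?_, ?_, isGreatest_LamStar, ?_, le_kap, kap_lt⟩
  · rw [sum_below_signed hm]
    exact approx_eq_sum_tau m n hc
  · rw [sum_below_signed hm]
    exact approx_eq_sum_tau_shifted m n hc
  · rw [sum_below_signed hm fun _ => 1]
    simpa using sum_tauVec hm
  · intro M hM
    have hm0 : (0 : ℝ) < m := by exact_mod_cast hm
    -- The hypothesis bounds an absolute value for at least one pair: α = 2m times the first unit
    -- vector (available as p ≥ 1) and u = 0.
    have hM0 : 0 ≤ M := (abs_nonneg _).trans
      (hM (Pi.single ⟨0, hp⟩ (2 * m)) (by simp) 0 fun r => by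
        simp only [Pi.zero_apply]
        constructor <;> linarith)
    refine ⟨abs_remainder_le hp hm n hf hM, ?_, fun h2 =>
      remainderBound_le_closedBound_of_two_le hp h2 (by norm_num) hM0⟩
    rcases hm.eq_or_lt with rfl | h2
    · exact remainderBound_le_closedBound hp le_rfl hM0 scaledMoment_one_le
    · exact remainderBound_le_closedBound_of_two_le hp h2 (by norm_num) hM0
  · have h1 := lt_LamStar
    have h2 := LamStar_lt
    constructor <;> norm_num at * <;> linarith
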